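/- Let $\mathcal X\subseteq\mathbb R^d$ be a Borel set, $\mathcal Y$ a finite set of labels, $p^*$ a probability distribution on $\mathcal X\times\mathcal Y$, and $\Phi:\mathcal X\times\mathcal Y\to\mathbb R^m$ a Borel measurable map with $\|\Phi(x,y)\|_\infty\le C$ for all $x,y$. A classification rule is a Markov transition $h(y|x)$ from $\mathcal X$ to $\mathcal Y$; its expected 0-1 loss under a distribution $p$ on $\mathcal X\times\mathcal Y$ is $\ell(h,p)=\mathbb E_{p}\{1-h(y|x)\}$, and $R(h)=\ell(h,p^*)$. For $\tau,\lambda\in\mathbb R^m$ let $$\mathcal U=\{p \text{ a probability distribution on } \mathcal X\times\mathcal Y:\ |\mathbb E_p\Phi-\tau|\preceq\lambda\},\qquad \overline R(\mathcal U)=\inf_h\sup_{p\in\mathcal U}\ell(h,p),$$ the infimum being over all classification rules. Call $\mathcal U$ regular if one of the following holds: (R1) $\mathcal X$ is finite and $\mathcal U\neq\emptyset$; (R2) there is $p\in\mathcal U$ with $|\mathbb E_p\Phi^{(i)}-\tau^{(i)}|<\lambda^{(i)}$ for every $i$ with $\lambda^{(i)}>0$, and either $\lambda^{(i)}>0$ for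 all $i$, or the support of $\Phi(x,y)$ for $(x,y)\sim p$ is not contained in a proper affine subspace of $\mathbb R^m$. Let $s\ge1$, let $\mathcal X_s=\{x_1,\dots,x_s\}$ consist of $s$ i.i.d. instances drawn from the $\mathcal X$-marginal of $p^*$, and put $$\varphi_s(\mu)=\max_{x\in\mathcal X_s,\ \emptyset\ne\mathcal C\subseteq\mathcal Y}\frac{\sum_{y\in\mathcal C}\Phi(x,y)^{T}\mu-1}{|\mathcal C|},\qquad \overline R_s(\mathcal U)=\inf_{\mu\in\mathbb R^m}\,1-\tau^T\mu+\varphi_s(\mu)+\lambda^T|\mu| .$$ Given a minimizer $\mu^*$ of the last problem, let $h_s$ be the rule on $\mathcal X$ given by $h_s(y|x)=(\Phi(x,y)^T\mu^*-\varphi_s(\mu^*))_+/c_x$ if $c_x\neq0$ and $h_s(y|x)=1/|\mathcal Y|$ if $c_x=0$, where $c_x=\sum_{y\in\mathcal Y}(\Phi(x,y)^T\mu^*-\varphi_s(\mu^*))_+$. Consider the problems $$\underline R_s(\mathcal U)=\sup_\mu\ 1-\tau^T\mu+\min_{x\in\mathcal X_s,\,y\in\mathcal Y}\{\Phi(x,y)^T\mu-h_s(y|x)\}-\lambda^T|\mu|,$$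 $$\inf_\mu\ 1-\tau^T\mu+\max_{x\in\mathcal X_s,\,y\in\mathcal Y}\{\Phi(x,y)^T\mu-h_s(y|x)\}+\lambda^T|\mu| ,$$ and denote by $\mu_l$ and $\mu_u$ solutions of the first and of the second one, respectively. For $\delta>0$ let $$\varepsilon_s=6|\mathcal Y|\sqrt{\frac{4+|\mathcal Y|(m+1)\log s+\log(|\mathcal Y|/\delta)}{s}} .$$ Let the vectors $\tau,\lambda$ be random (they may depend on $\mathcal X_s$ in any way). If, with probability at least $1-\delta$, $\mathcal U$ is regular, $p^*\in\mathcal U$ and $\overline R_s(\mathcal U)$ is finite, then with probability at least $1-2\delta$ solutions $\mu^*$ exist, for each of them solutions $\mu_l$, $\mu_u$ exist, and for all such solutions $$\underline R_s(\mathcal U)-\varepsilon_s(2C\|\mu_l\|_1+1)\le R(h_s)\le\overline R_s(\mathcal U)+\varepsilon_s(2C\|\mu_u\|_1+1)\le\overline R(\mathcal U)+\varepsilon_s(2C\|\mu_u\|_1+1).$$ -/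

import Mathlib

open MeasureTheory ProbabilityTheory Matrix

noncomputable section

namespace MRC

/-- A classification rule (Markov transition from instances to labels): `h x y` is the probability
`h(y|x)` with which the instance `x` is given the label `y`. -/
structure IsRule {X Y : Type*} [MeasurableSpace X] [Fintype Y] (h : X → Y → ℝ) : Prop where
  measurable : ∀ y, Measurable fun x => h x y
  mem_simplex : ∀ x, h x ∈ stdSimplex ℝ Y

/-- Expected 0-1 loss `ℓ(h, p) = 𝔼_p [1 - h(y|x)]`. -/
def risk {X Y : Type*} [MeasurableSpace X] [MeasurableSpace Y]
    (p : Measure (X × Y)) (h : X → Y → ℝ) : ℝ :=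
  ∫ z, (1 - h z.1 z.2) ∂p

/-- The uncertainty set of the probability measures `p` on `X × Y` such that
`|𝔼_p Φ - τ| ≤ lam` componentwise. -/
def uncertaintySet {X Y : Type*} [MeasurableSpace X] [MeasurableSpace Y] {m : ℕ}
    (Φ : X → Y → Fin m → ℝ) (τ lam : Fin m → ℝ) : Set (Measure (X × Y)) :=
  {p | IsProbabilityMeasure p ∧ ∀ i, |(∫ z, Φ z.1 z.2 i ∂p) - τ i| ≤ lam i}

/-- The regularity condition on uncertainty sets. The first alternative is (R1): `X` is finite and
the uncertainty set is non-empty. The second one is (R2): some `p` in the uncertainty set meets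
strictly all the constraints with `lam i > 0`, and either all the `lam i` are positive (R2.1), or
the support of the random vector `Φ(x, y)`, `(x, y) ∼ p`, is not contained in a proper affine
subspace (R2.2). -/
def Regular {X Y : Type*} [MeasurableSpace X] [MeasurableSpace Y] {m : ℕ}
    (Φ : X → Y → Fin m → ℝ) (τ lam : Fin m → ℝ) : Prop :=
  (Finite X ∧ (uncertaintySet Φ τ lam).Nonempty) ∨
  ∃ p ∈ uncertaintySet Φ τ lam,
    (∀ i, 0 < lam i → |(∫ z, Φ z.1 z.2 i ∂p) - τ i| < lam i) ∧
    ((∀ i, 0 < lam i) ∨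
      ∀ V : AffineSubspace ℝ (Fin m → ℝ), V ≠ ⊤ →
        ¬ (p.map fun z => Φ z.1 z.2).support ⊆ (V : Set (Fin m → ℝ)))

/-- The minimax risk `inf_h sup_{p ∈ U} ℓ(h, p)`, with `h` ranging over all classification rules.
(For a non-empty `U`, all the values involved lie in `[0, 1]`.) -/
def minimaxRisk {X Y : Type*} [MeasurableSpace X] [MeasurableSpace Y] [Fintype Y]
    (U : Set (Measure (X × Y))) : ℝ :=
  sInf ((fun h : X → Y → ℝ => sSup ((fun p => risk p h) '' U)) '' {h | IsRule h})

/-- `φ(μ) = sup (∑_{y ∈ C} Φ(x, y)ᵀ μ - 1) / |C|` over the instances `x` in `S` and the non-empty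
sets `C` of labels. -/
def phi {X Y : Type*} {m : ℕ} (Φ : X → Y → Fin m → ℝ) (S : Set X) (μ : Fin m → ℝ) : ℝ :=
  sSup {v | ∃ x ∈ S, ∃ C : Finset Y, C.Nonempty ∧
    v = ((∑ y ∈ C, Φ x y ⬝ᵥ μ) - 1) / (C.card : ℝ)}

/-- Objective, to be minimized over `μ`, of the learning problem on the set of instances `S`:
`1 - τᵀ μ + φ(μ) + lamᵀ |μ|`. -/
def learnObj {X Y : Type*} {m : ℕ} (Φ : X → Y → Fin m → ℝ) (τ lam : Fin m → ℝ) (S : Set X)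
    (μ : Fin m → ℝ) : ℝ :=
  1 - τ ⬝ᵥ μ + phi Φ S μ + ∑ i, lam i * |μ i|

/-- The rule determined by a parameter `μ` (and by `S` through `φ`), on the whole of `X`: the
normalization of the positive part of `Φ(x, y)ᵀ μ - φ(μ)`, and the uniform distribution on the
labels where that positive part vanishes for all labels. -/
def mrcRule {X Y : Type*} [Fintype Y] {m : ℕ} (Φ : X → Y → Fin m → ℝ) (S : Set X)
    (μ : Fin m → ℝ) (x : X) (y : Y) : ℝ :=
  open Classical in
  if (∑ y', max (Φ x y' ⬝ᵥ μ - phi Φ S μ) 0) = 0 then 1 / (Fintype.card Y : ℝ)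
  else max (Φ x y ⬝ᵥ μ - phi Φ S μ) 0 / ∑ y', max (Φ x y' ⬝ᵥ μ - phi Φ S μ) 0

/-- Objective, to be maximized over `μ`, of the lower-bound problem for the rule `h` on `S`. -/
def lowerObj {X Y : Type*} {m : ℕ} (Φ : X → Y → Fin m → ℝ) (τ lam : Fin m → ℝ) (S : Set X)
    (h : X → Y → ℝ) (μ : Fin m → ℝ) : ℝ :=
  1 - τ ⬝ᵥ μ + sInf {v | ∃ x ∈ S, ∃ y, v = Φ x y ⬝ᵥ μ - h x y} - ∑ i, lam i * |μ i|

/-- Objective, to be minimized over `μ`, of the upper-bound problem for the rule `h` on `S`. -/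
def upperObj {X Y : Type*} {m : ℕ} (Φ : X → Y → Fin m → ℝ) (τ lam : Fin m → ℝ) (S : Set X)
    (h : X → Y → ℝ) (μ : Fin m → ℝ) : ℝ :=
  1 - τ ⬝ᵥ μ + sSup {v | ∃ x ∈ S, ∃ y, v = Φ x y ⬝ᵥ μ - h x y} + ∑ i, lam i * |μ i|

/-- The upper bound: the optimal value of the learning problem on `S`. It is finite if and only if
the range of the objective is bounded below. -/
def upperValue {X Y : Type*} {m : ℕ} (Φ : X → Y → Fin m → ℝ) (τ lam : Fin m → ℝ)
    (S : Set X) : ℝ :=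
  ⨅ μ, learnObj Φ τ lam S μ

/-- The lower bound: the optimal value of the lower-bound problem for the rule `h` on `S`. -/
def lowerValue {X Y : Type*} {m : ℕ} (Φ : X → Y → Fin m → ℝ) (τ lam : Fin m → ℝ) (S : Set X)
    (h : X → Y → ℝ) : ℝ :=
  ⨆ μ, lowerObj Φ τ lam S h μ

/-- `ε_s`, for `k` labels, `m` features and confidence parameter `δ`. -/
def epsilon (k m : ℕ) (δ : ℝ) (s : ℕ) : ℝ :=
  6 * k * √((4 + k * (m + 1) * Real.log s + Real.log (k / δ)) / s)

end MRC

end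

/-! The three inequalities rest on linear programming duality over the sample and on one uniform
deviation bound. Every objective is, up to sign, a maximum of finitely many affine functions, so if
bounded below it attains its minimum and is certified by a convex combination of pieces with zero
total slope (`exists_minimizer_and_dual_max_affine`). For the learning problem the certificate is a
distribution in the uncertainty set, supported on sampled instances, under which every rule has risk
at least the optimal value. This gives the comparison with the minimax risk
(`exists_isMinOn_learnObj`). For the risk bounds, `risk_eq_add_integral` splits the risk into 1
minus the mean score plus the mean gap `Φ(x, y)ᵀ μ' - h(y|x)`. Membership of `pstar` in the
uncertainty set replaces the mean score by `τᵀ μ'` at the cost of `lamᵀ |μ'|`. It remains to compare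
the mean gap with its maximum or minimum M over the sample. On the sample, the learned rule
dominates `Φᵀ μ - φ(μ)`, so the upper problem at `μ` itself is at most the learning value
(`upperObj_mrcRule_le_learnObj`). The gap is beyond M nowhere on the sample, so a set of instances
where it is beyond M avoids the sample. Rounding the rule to multiples of 1/s makes such sets
describable by signs of finitely many linear functionals of a parameter in dimension 2m+3
(`ruleFunctionals`). The Sauer-Shelah lemma bounds the number of sign patterns, and the
double-sample argument shows that, with high probability, all sets of this class that avoid the
sample have probability at most 5ε/6 (`measureReal_exists_avoiding_signClass_mul_le`). Elsewhere the
gap is beyond M by at most 1/s ≤ ε/6, and everywhere by at most its range `2C‖μ'‖₁ + 1`; together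
these give the stated error. The parameters may depend on the sample, and so may `τ` and `lam`,
because the bound is uniform over them. -/

/-! ### Attainment and duality for maxima of affine functions -/

/-- A convex piecewise linear function `max_{j ∈ T} (a j ⬝ᵥ μ + b j)` that is bounded below attains
its minimum. -/
theorem exists_minimizer_max_affine {J ι : Type*} [Fintype ι] (a : J → ι → ℝ) (b : J → ℝ) (c : ℝ)
    (T : Finset J) (hT : ∀ μ, ∃ j ∈ T, c ≤ a j ⬝ᵥ μ + b j) :
    ∃ μ₀, ∀ μ, ∃ j ∈ T, ∀ i ∈ T, a i ⬝ᵥ μ₀ + b i ≤ a j ⬝ᵥ μ + b j := by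
  classical
  induction T using Finset.strongInduction with
  | H T ih =>
  -- If no slope increases along v and some decreases, the decreasing pieces sink below c far along
  -- v and can be discarded, leaving fewer pieces. If there is no such v, the maximum of the linear
  -- parts is positive at every nonzero point of their range, hence coercive there.
  by_cases hrec : ∃ v, (∀ j ∈ T, a j ⬝ᵥ v ≤ 0) ∧ ∃ j ∈ T, a j ⬝ᵥ v < 0
  · obtain ⟨v, hv, j₀, hj₀, hj₀v⟩ := hrec
    have far : ∀ μ, ∃ t : ℝ, ∀ j ∈ T, a j ⬝ᵥ v ≠ 0 → a j ⬝ᵥ (μ + t • v) + b j < c := by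
      intro μ
      have : ∀ᶠ t : ℝ in Filter.atTop, ∀ j ∈ T, a j ⬝ᵥ v ≠ 0 →
          a j ⬝ᵥ (μ + t • v) + b j < c := by
        rw [Filter.eventually_all_finset]
        intro j hj
        by_cases h0 : a j ⬝ᵥ v = 0
        · simp [h0]
        have hneg : a j ⬝ᵥ v < 0 := lt_of_le_of_ne (hv j hj) h0
        have := (Filter.tendsto_id.atTop_mul_const_of_neg hneg).eventually_lt_atBot
          (c - a j ⬝ᵥ μ - b j)
        filter_upwards [this] with t ht _
        rw [dotProduct_add, dotProduct_smul, smul_eq_mul]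
        simp only [id] at ht
        linarith
      exact this.exists
    have stay : ∀ μ (t : ℝ) j, a j ⬝ᵥ v = 0 → a j ⬝ᵥ (μ + t • v) = a j ⬝ᵥ μ := by
      intro μ t j h
      simp [dotProduct_add, h]
    have hT' : ∀ μ, ∃ j ∈ T.filter (fun j => a j ⬝ᵥ v = 0), c ≤ a j ⬝ᵥ μ + b j := by
      intro μ
      obtain ⟨t, ht⟩ := far μ
      obtain ⟨j, hj, hcj⟩ := hT (μ + t • v)
      have h0 : a j ⬝ᵥ v = 0 := by
        by_contra h0
        exact absurd (ht j hj h0) (not_lt.2 hcj)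
      refine ⟨j, Finset.mem_filter.2 ⟨hj, h0⟩, ?_⟩
      rwa [stay μ t j h0] at hcj
    obtain ⟨μ₀, hμ₀⟩ := ih _ (Finset.filter_ssubset.2 ⟨j₀, hj₀, hj₀v.ne⟩) hT'
    obtain ⟨t, ht⟩ := far μ₀
    refine ⟨μ₀ + t • v, fun μ => ?_⟩
    obtain ⟨j, hj, hjle⟩ := hμ₀ μ
    obtain ⟨i₀, hi₀, hci₀⟩ := hT' μ₀
    refine ⟨j, (Finset.mem_filter.1 hj).1, fun i hi => ?_⟩
    by_cases h0 : a i ⬝ᵥ v = 0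
    · rw [stay μ₀ t i h0]
      exact hjle i (Finset.mem_filter.2 ⟨hi, h0⟩)
    · exact ((ht i hi h0).le.trans hci₀).trans (hjle i₀ hi₀)
  · push Not at hrec
    have hne : T.Nonempty := by
      obtain ⟨j, hj, -⟩ := hT 0
      exact ⟨j, hj⟩
    have : Nonempty T := hne.to_subtype
    let A : Matrix T ι ℝ := fun j => a j
    let K : Submodule ℝ (T → ℝ) := LinearMap.range A.mulVecLin
    have hKc : IsClosed (K : Set (T → ℝ)) := K.closed_of_finiteDimensional
    have hune : (Finset.univ : Finset T).Nonempty := Finset.univ_nonempty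
    let mx : (T → ℝ) → ℝ := fun u => Finset.univ.sup' hune fun j => u j
    have hmxc : Continuous mx := by
      refine Continuous.finset_sup'_apply hune fun j _ => continuous_apply j
    have hpos : ∀ u ∈ K, u ≠ 0 → 0 < mx u := by
      rintro _ ⟨v, rfl⟩ hu
      by_contra hle
      have h1 : ∀ j : T, a j ⬝ᵥ v ≤ 0 := fun j =>
        (Finset.le_sup' (fun j => (A.mulVecLin v) j) (Finset.mem_univ j)).trans (not_lt.1 hle)
      refine hu (funext fun j => ?_)
      exact le_antisymm (h1 j) (hrec v (fun j hj => h1 ⟨j, hj⟩) j j.2)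
    -- Compactness of the unit sphere of K makes the positivity uniform; homogeneity then extends it
    -- to K. The range, rather than the space of μ, is used because A may have a kernel.
    obtain ⟨κ, hκ, hκK⟩ : ∃ κ > 0, ∀ u ∈ K, κ * ‖u‖ ≤ mx u := by
      have hcomp : IsCompact ((K : Set (T → ℝ)) ∩ Metric.sphere 0 1) :=
        (isCompact_sphere 0 1).inter_left hKc
      by_cases hnon : ((K : Set (T → ℝ)) ∩ Metric.sphere 0 1).Nonempty
      · obtain ⟨u₀, hu₀, hmin⟩ := hcomp.exists_isMinOn hnon hmxc.continuousOn
        have hu₀0 : u₀ ≠ 0 := by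
          rintro rfl
          simpa using hu₀.2
        refine ⟨mx u₀, hpos u₀ hu₀.1 hu₀0, fun u hu => ?_⟩
        by_cases hu0 : u = 0
        · subst hu0
          simp [mx]
        have hn : 0 < ‖u‖ := norm_pos_iff.2 hu0
        have hmem : ‖u‖⁻¹ • u ∈ (K : Set (T → ℝ)) ∩ Metric.sphere 0 1 :=
          ⟨K.smul_mem _ hu, by simp [norm_smul, hn.ne']⟩
        have h2 : mx u₀ ≤ mx (‖u‖⁻¹ • u) := hmin hmem
        obtain ⟨j, -, hj⟩ := Finset.exists_mem_eq_sup' hune fun j => (‖u‖⁻¹ • u) j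
        have h3 : mx (‖u‖⁻¹ • u) ≤ ‖u‖⁻¹ * mx u := by
          change Finset.univ.sup' hune (fun j => (‖u‖⁻¹ • u) j) ≤ _
          rw [hj]
          exact mul_le_mul_of_nonneg_left
            (Finset.le_sup' (fun j => u j) (Finset.mem_univ j)) (by positivity)
        have h4 := h2.trans h3
        rw [inv_mul_eq_div, le_div_iff₀ hn] at h4
        exact h4
      · refine ⟨1, one_pos, fun u hu => ?_⟩
        have hu0 : u = 0 := by
          by_contra hu0
          have hn : 0 < ‖u‖ := norm_pos_iff.2 hu0
          exact hnon ⟨‖u‖⁻¹ • u, K.smul_mem _ hu, by simp [norm_smul, hn.ne']⟩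
        subst hu0
        simp [mx]
    let g : (T → ℝ) → ℝ := fun u => Finset.univ.sup' hune fun j => u j + b j
    have hgc : Continuous g :=
      Continuous.finset_sup'_apply hune fun j _ => (continuous_apply j).add continuous_const
    have hle : ∀ u, mx u ≤ g u + ∑ j : T, |b j| := by
      intro u
      refine Finset.sup'_le _ _ fun j _ => ?_
      have h1 : u j + b j ≤ g u := Finset.le_sup' (fun j : T => u j + b j) (Finset.mem_univ j)
      have h2 : |b j| ≤ ∑ j : T, |b j| :=
        Finset.single_le_sum (f := fun j : T => |b j|) (fun _ _ => abs_nonneg _)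
          (Finset.mem_univ j)
      have := neg_abs_le (b j)
      linarith
    have hcompL : IsCompact ((K : Set (T → ℝ)) ∩ {u | g u ≤ g 0}) := by
      refine Metric.isCompact_of_isClosed_isBounded
        (hKc.inter (isClosed_le hgc continuous_const)) ?_
      refine (Metric.isBounded_closedBall (x := (0 : T → ℝ))
        (r := (g 0 + ∑ j : T, |b j|) / κ)).subset fun u hu => ?_
      rw [mem_closedBall_zero_iff, le_div_iff₀ hκ, mul_comm]
      have h1 := hκK u hu.1
      have h2 := hle u
      have h3 : g u ≤ g 0 := hu.2
      linarith
    obtain ⟨u₀, hu₀, hmin⟩ := hcompL.exists_isMinOn ⟨0, K.zero_mem, le_refl (g 0)⟩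
      hgc.continuousOn
    obtain ⟨μ₀, hμ₀⟩ := hu₀.1
    refine ⟨μ₀, fun μ => ?_⟩
    have hglob : g u₀ ≤ g (A.mulVecLin μ) := by
      by_cases h : g (A.mulVecLin μ) ≤ g 0
      · exact hmin ⟨⟨μ, rfl⟩, h⟩
      · exact (hu₀.2 : g u₀ ≤ g 0).trans (not_le.1 h).le
    obtain ⟨j, -, hj⟩ := Finset.exists_mem_eq_sup' hune fun j : T => (A.mulVecLin μ) j + b j
    refine ⟨j, j.2, fun i hi => ?_⟩
    have h1 : u₀ ⟨i, hi⟩ + b i ≤ g u₀ :=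
      Finset.le_sup' (fun j : T => u₀ j + b j) (Finset.mem_univ (⟨i, hi⟩ : T))
    rw [← hμ₀] at h1
    have h2 : g (A.mulVecLin μ) = (A.mulVecLin μ) j + b j := hj
    exact h1.trans ((hμ₀ ▸ hglob).trans h2.le)

/-- Strong duality for the minimization of a convex piecewise linear function that is bounded
below: the minimum is attained and certified by a convex combination of the pieces. -/
theorem exists_minimizer_and_dual_max_affine {J ι : Type*} [Fintype J] [Fintype ι]
    (a : J → ι → ℝ) (b : J → ℝ) (c : ℝ) (h : ∀ μ, ∃ j, c ≤ a j ⬝ᵥ μ + b j) :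
    ∃ μ₀, ∃ w ∈ stdSimplex ℝ J, ∑ j, w j • a j = 0 ∧
      ∀ j, a j ⬝ᵥ μ₀ + b j ≤ ∑ i, w i * b i := by
  classical
  obtain ⟨μ₀, hμ₀⟩ := exists_minimizer_max_affine a b c Finset.univ (by simpa using h)
  obtain ⟨j₀, -, hj₀⟩ := hμ₀ μ₀
  set v := a j₀ ⬝ᵥ μ₀ + b j₀ with hv
  let T : Finset J := Finset.univ.filter fun j => a j ⬝ᵥ μ₀ + b j = v
  -- Optimality condition: if 0 were outside the hull of the active slopes, a separating functional
  -- d would make every active piece decrease, and a short step along d would beat the minimum.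
  have hmem : (0 : ι → ℝ) ∈ convexHull ℝ (a '' (T : Set J)) := by
    by_contra h0
    have hcl : IsClosed (convexHull ℝ (a '' (T : Set J))) :=
      (T.finite_toSet.image a).isClosed_convexHull ℝ
    obtain ⟨f, u, hfu, hu0⟩ := geometric_hahn_banach_closed_point (convex_convexHull ℝ _) hcl h0
    rw [map_zero] at hu0
    let d : ι → ℝ := fun i => f (Pi.single i 1)
    have hfd : ∀ z, f z = z ⬝ᵥ d := by
      intro z
      conv_lhs => rw [pi_eq_sum_univ' z, map_sum]
      refine Finset.sum_congr rfl fun i _ => ?_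
      rw [map_smul, smul_eq_mul]
    have hneg : ∀ j ∈ T, a j ⬝ᵥ d < 0 := fun j hj => by
      rw [← hfd]
      exact (hfu _ (subset_convexHull ℝ _ ⟨j, hj, rfl⟩)).trans hu0
    have hev : ∀ᶠ t : ℝ in nhdsWithin 0 (Set.Ioi 0), ∀ j, a j ⬝ᵥ (μ₀ + t • d) + b j < v := by
      rw [Filter.eventually_all]
      intro j
      by_cases hj : j ∈ T
      · filter_upwards [self_mem_nhdsWithin] with t ht
        have h1 := hneg j hj
        have h2 : a j ⬝ᵥ μ₀ + b j = v := (Finset.mem_filter.1 hj).2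
        rw [dotProduct_add, dotProduct_smul, smul_eq_mul]
        have : t * (a j ⬝ᵥ d) < 0 := mul_neg_of_pos_of_neg ht h1
        linarith
      · have hlt : a j ⬝ᵥ μ₀ + b j < v := by
          refine lt_of_le_of_ne (hj₀ j (Finset.mem_univ j)) fun he => hj ?_
          exact Finset.mem_filter.2 ⟨Finset.mem_univ j, he⟩
        have hc : Continuous fun t : ℝ => a j ⬝ᵥ (μ₀ + t • d) + b j := by
          simp only [dotProduct_add, dotProduct_smul, smul_eq_mul]
          fun_prop
        refine nhdsWithin_le_nhds (hc.continuousAt.eventually_lt continuousAt_const ?_)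
        simpa using hlt
    obtain ⟨t, ht⟩ := hev.exists
    obtain ⟨j, -, hj⟩ := hμ₀ (μ₀ + t • d)
    have := ht j
    have := hj j₀ (Finset.mem_univ _)
    linarith
  obtain ⟨κ, _, w, z, hw0, hw1, hz, hsum⟩ := mem_convexHull_iff_exists_fintype.1 hmem
  choose r hrT hr using hz
  -- The convex combination may repeat a slope, so the weights of equal representatives `r k` are
  -- merged.
  refine ⟨μ₀, fun j => ∑ k, if r k = j then w k else 0,
    ⟨fun j => Finset.sum_nonneg fun k _ => by split_ifs <;> simp [hw0], ?_⟩, ?_, fun j => ?_⟩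
  · rw [Finset.sum_comm]
    simpa using hw1
  · simp only [Finset.sum_smul, ite_smul, zero_smul]
    rw [Finset.sum_comm]
    simpa [hr] using hsum
  · have h1 : ∑ i, (∑ k, if r k = i then w k else 0) * b i = ∑ k, w k * b (r k) := by
      simp only [Finset.sum_mul, ite_mul, zero_mul]
      rw [Finset.sum_comm]
      simp
    rw [h1]
    have h2 : ∀ k, w k * b (r k) = w k * v - w k * (z k ⬝ᵥ μ₀) := fun k => by
      have : a (r k) ⬝ᵥ μ₀ + b (r k) = v := (Finset.mem_filter.1 (hrT k)).2
      rw [← hr k, ← this]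
      ring
    have h3 : ∑ k, w k * (z k ⬝ᵥ μ₀) = 0 := by
      have : (∑ k, w k • z k) ⬝ᵥ μ₀ = 0 := by rw [hsum, zero_dotProduct]
      simpa [sum_dotProduct, smul_dotProduct] using this
    simp only [h2, Finset.sum_sub_distrib, h3, ← Finset.sum_mul, hw1]
    have := hj₀ j (Finset.mem_univ j)
    linarith

/-! ### Counting and measurability of sign patterns -/

theorem Nat.sum_choose_le_succ_pow (n D : ℕ) :
    ∑ k ∈ Finset.Iic D, n.choose k ≤ (n + 1) ^ D := by
  rw [add_pow, Nat.range_succ_eq_Iic]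
  refine Finset.sum_le_sum fun k hk => ?_
  have h1 : n.choose k ≤ n ^ k := Nat.choose_le_pow n k
  have h2 : 1 ≤ D.choose k := Nat.choose_pos (Finset.mem_Iic.1 hk)
  simpa using Nat.mul_le_mul h1 h2

open Classical in
/-- The sign patterns of the linear functionals `a k`, as sets of indices of positive values. -/
noncomputable def signPatterns {κ ι : Type*} [Fintype κ] [Fintype ι] (a : κ → ι → ℝ) :
    Finset (Finset κ) :=
  Finset.univ.filter fun S => ∃ θ, ∀ k, k ∈ S ↔ 0 < a k ⬝ᵥ θ

theorem mem_signPatterns {κ ι : Type*} [Fintype κ] [Fintype ι] {a : κ → ι → ℝ} {S : Finset κ} :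
    S ∈ signPatterns a ↔ ∃ θ, ∀ k, k ∈ S ↔ 0 < a k ⬝ᵥ θ := by
  simp [signPatterns]

open Classical in
/-- Homogeneous half-spaces of `ℝ^ι` have VC dimension at most the dimension of the space. -/
theorem vcDim_signPatterns_le {κ ι : Type*} [Fintype κ] [Fintype ι] (a : κ → ι → ℝ) :
    (signPatterns a).vcDim ≤ Fintype.card ι := by
  refine Finset.sup_le fun s hs => ?_
  rw [Finset.mem_shatterer] at hs
  by_contra hcard
  -- A shattered set larger than the dimension carries a relation ∑ g k • a k = 0. Realizing exactly
  -- the set of positive g k by some θ makes every term of ∑ g k (a k ⬝ᵥ θ) nonnegative and one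
  -- positive, although the sum is 0.
  have hdep : ¬ LinearIndependent ℝ fun k : s => a k := fun hli => by
    have := hli.fintype_card_le_finrank
    simp at this
    omega
  obtain ⟨g, hg, i₀, hi₀⟩ := Fintype.not_linearIndependent_iff.1 hdep
  obtain ⟨g, hg, i₀, hi₀⟩ : ∃ g : s → ℝ, ∑ i, g i • a i = 0 ∧ ∃ i, 0 < g i := by
    rcases lt_or_gt_of_ne hi₀ with h | h
    · refine ⟨-g, ?_, i₀, by simpa using h⟩
      simp only [Pi.neg_apply, neg_smul, Finset.sum_neg_distrib, hg, neg_zero]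
    · exact ⟨g, hg, i₀, h⟩
  obtain ⟨t, ht, hst⟩ := hs (t := s.filter fun k => ∃ h : k ∈ s, 0 < g ⟨k, h⟩)
    (Finset.filter_subset _ _)
  obtain ⟨θ, hθ⟩ := mem_signPatterns.1 ht
  have hiff : ∀ k : s, 0 < a k ⬝ᵥ θ ↔ 0 < g k := by
    intro k
    rw [← hθ k]
    have := Finset.ext_iff.1 hst k
    simpa using this
  have hsum : ∑ k : s, g k * (a k ⬝ᵥ θ) = 0 := by
    have : (∑ k, g k • a k) ⬝ᵥ θ = 0 := by rw [hg, zero_dotProduct]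
    simpa [sum_dotProduct, smul_dotProduct] using this
  refine (Finset.sum_pos' (fun k _ => ?_) ⟨i₀, Finset.mem_univ _, ?_⟩).ne' hsum
  · by_cases h : 0 < g k
    · exact (mul_pos h ((hiff k).2 h)).le
    · exact mul_nonneg_of_nonpos_of_nonpos (not_lt.1 h) (not_lt.1 fun h' => h ((hiff k).1 h'))
  · exact mul_pos hi₀ ((hiff i₀).2 hi₀)

/-- Sauer-Shelah combined with the bound on the VC dimension. -/
theorem card_signPatterns_le {κ ι : Type*} [Fintype κ] [Fintype ι] (a : κ → ι → ℝ) :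
    (signPatterns a).card ≤ (Fintype.card κ + 1) ^ Fintype.card ι := by
  classical
  refine (Finset.card_le_card_shatterer _).trans ?_
  refine Finset.card_shatterer_le_sum_vcDim.trans ?_
  refine (Finset.sum_le_sum_of_subset ?_).trans (Nat.sum_choose_le_succ_pow _ _)
  exact Finset.Iic_subset_Iic.2 (vcDim_signPatterns_le a)

/-- Solvability of systems of strict and non-strict homogeneous linear inequalities is a measurable
condition on the coefficients. -/
theorem measurableSet_exists_signs {κ ι : Type*} [Fintype κ] [Fintype ι] (S : Set κ) :
    MeasurableSet {b : κ → ι → ℝ | ∃ θ, ∀ k, 0 < b k ⬝ᵥ θ ↔ k ∈ S} := by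
  have hpos : ∀ k, IsOpen {q : (κ → ι → ℝ) × (ι → ℝ) | 0 < q.1 k ⬝ᵥ q.2} := fun k =>
    isOpen_lt continuous_const (by fun_prop)
  have hfs : ∀ k, ∃ F : ℕ → Set ((κ → ι → ℝ) × (ι → ℝ)), (∀ n, IsClosed (F n)) ∧
      ⋃ n, F n = {q | 0 < q.1 k ⬝ᵥ q.2 ↔ k ∈ S} := by
    intro k
    by_cases hk : k ∈ S
    · obtain ⟨F, hF, -, hU, -⟩ := (hpos k).exists_iUnion_isClosed
      exact ⟨F, hF, by simpa [hk] using hU⟩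
    · refine ⟨fun _ => {q | 0 < q.1 k ⬝ᵥ q.2}ᶜ, fun _ => (hpos k).isClosed_compl, ?_⟩
      ext q
      simp [hk]
  choose F hFc hFU using hfs
  -- Open and closed conditions are both countable unions of closed sets, and a finite-dimensional
  -- space is σ-compact. Projections preserve σ-compactness, so the existential quantifier over θ
  -- leaves a Borel set.
  have hσ : IsSigmaCompact {q : (κ → ι → ℝ) × (ι → ℝ) | ∀ k, 0 < q.1 k ⬝ᵥ q.2 ↔ k ∈ S} := by
    have : {q : (κ → ι → ℝ) × (ι → ℝ) | ∀ k, 0 < q.1 k ⬝ᵥ q.2 ↔ k ∈ S} =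
        ⋃ n : κ → ℕ, ⋂ k, F k (n k) := by
      ext q
      simp only [Set.mem_ofPred_eq, Set.mem_iUnion, Set.mem_iInter]
      rw [← Classical.skolem (p := fun k n => q ∈ F k n)]
      refine forall_congr' fun k => ?_
      rw [← Set.mem_iUnion, hFU]
      rfl
    rw [this]
    exact isSigmaCompact_iUnion _ fun n => isSigmaCompact_univ.of_isClosed_subset
      (isClosed_iInter fun k => hFc k (n k)) (Set.subset_univ _)
  obtain ⟨K, hK, hKU⟩ := hσ.image continuous_fst
  have : {b : κ → ι → ℝ | ∃ θ, ∀ k, 0 < b k ⬝ᵥ θ ↔ k ∈ S} = ⋃ n, K n := by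
    rw [hKU]
    ext b
    simp
  rw [this]
  exact MeasurableSet.iUnion fun n => (hK n).measurableSet

theorem measurableSet_exists_signs_mem {Z κ ι : Type*} [MeasurableSpace Z] [Fintype κ] [Fintype ι]
    {b : Z → κ → ι → ℝ} (hb : Measurable b) (𝓖 : Set (Set κ)) :
    MeasurableSet {z | ∃ θ, {k | 0 < b z k ⬝ᵥ θ} ∈ 𝓖} := by
  have : {z | ∃ θ, {k | 0 < b z k ⬝ᵥ θ} ∈ 𝓖} =
      ⋃ S ∈ 𝓖, b ⁻¹' {b : κ → ι → ℝ | ∃ θ, ∀ k, 0 < b k ⬝ᵥ θ ↔ k ∈ S} := by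
    ext z
    simp only [Set.mem_ofPred_eq, Set.mem_iUnion, Set.mem_preimage, exists_prop]
    constructor
    · rintro ⟨θ, hθ⟩
      exact ⟨_, hθ, θ, fun k => Iff.rfl⟩
    · rintro ⟨S, hS, θ, hθ⟩
      refine ⟨θ, ?_⟩
      rwa [show {k | 0 < b z k ⬝ᵥ θ} = S from Set.ext hθ]
  rw [this]
  exact MeasurableSet.biUnion (Set.to_countable _) fun S _ => hb (measurableSet_exists_signs S)

/-! ### Double-sample bound for classes defined by signs -/

/-- Among the `2 ^ s` choices of one element in each of `s` pairs, those that avoid `B` while the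
other elements hit `B` at least `r` times are a fraction at most `2 ^ (-r)`. -/
theorem card_choices_avoiding_mul_le {s : ℕ} (B : Fin s → Bool → Prop) (r : ℕ)
    (T : Finset (Fin s → Bool)) (hT : ∀ σ ∈ T, (∀ i, ¬ B i (σ i)) ∧
      ∃ I : Finset (Fin s), r ≤ I.card ∧ ∀ i ∈ I, B i (!σ i)) :
    T.card * 2 ^ r ≤ 2 ^ s := by
  classical
  rcases T.eq_empty_or_nonempty with rfl | ⟨σ₀, hσ₀⟩
  · simp
  obtain ⟨-, I, hI, hIB⟩ := hT σ₀ hσ₀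
  have h₀ := (hT σ₀ hσ₀).1
  -- Fix one member σ₀ with its hit set I. On I the unchosen element lies in B, so no other member
  -- can choose it: all members agree with σ₀ on I.
  have hsub : T ⊆ Fintype.piFinset fun i => if i ∈ I then {σ₀ i} else Finset.univ := by
    intro σ hσ
    rw [Fintype.mem_piFinset]
    intro i
    split_ifs with hi
    · rw [Finset.mem_singleton]
      by_contra hne
      have : σ i = !σ₀ i := by
        cases h1 : σ i <;> cases h2 : σ₀ i <;> simp_all
      exact (hT σ hσ).1 i (this ▸ hIB i hi)
    · exact Finset.mem_univ _
  have hcard : (Fintype.piFinset fun i => if i ∈ I then {σ₀ i} else Finset.univ).card =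
      2 ^ Iᶜ.card := by
    rw [Fintype.card_piFinset]
    have : ∀ i, (if i ∈ I then {σ₀ i} else Finset.univ : Finset Bool).card =
        if i ∈ Iᶜ then 2 else 1 := fun i => by
      by_cases hi : i ∈ I <;> simp [hi]
    simp only [this]
    rw [Finset.prod_ite_mem]
    simp
  calc T.card * 2 ^ r ≤ 2 ^ Iᶜ.card * 2 ^ I.card :=
        Nat.mul_le_mul ((Finset.card_le_card hsub).trans hcard.le)
          (Nat.pow_le_pow_right two_pos hI)
    _ = 2 ^ s := by
        rw [← pow_add, Finset.card_compl_add_card, Fintype.card_fin]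

/-- The set of the points where the signs of the linear functionals `a x j`, evaluated at the
parameter `θ`, form a pattern in `𝓕`. -/
def signClass {X J ι : Type*} [Fintype ι] (a : X → J → ι → ℝ) (𝓕 : Set (Set J)) (θ : ι → ℝ) :
    Set X :=
  {x | {j | 0 < a x j ⬝ᵥ θ} ∈ 𝓕}

theorem measurableSet_signClass {X J ι : Type*} [MeasurableSpace X] [Fintype J] [Fintype ι]
    {a : X → J → ι → ℝ} (ha : Measurable a) (𝓕 : Set (Set J)) (θ : ι → ℝ) :
    MeasurableSet (signClass a 𝓕 θ) := by
  have : signClass a 𝓕 θ = ⋃ S ∈ 𝓕, ⋂ j, {x | 0 < a x j ⬝ᵥ θ ↔ j ∈ S} := by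
    ext x
    simp only [signClass, Set.mem_ofPred_eq, Set.mem_iUnion, Set.mem_iInter, exists_prop]
    constructor
    · exact fun h => ⟨_, h, fun j => Iff.rfl⟩
    · rintro ⟨S, hS, h⟩
      rwa [show {j | 0 < a x j ⬝ᵥ θ} = S from Set.ext h]
  rw [this]
  refine MeasurableSet.biUnion (Set.to_countable _) fun S _ => MeasurableSet.iInter fun j => ?_
  have hm : Measurable fun x => a x j ⬝ᵥ θ := by
    unfold dotProduct
    fun_prop
  have hp : MeasurableSet {x | 0 < a x j ⬝ᵥ θ} := measurableSet_lt measurable_const hm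
  by_cases hj : j ∈ S
  · simpa [hj] using hp
  · simp only [hj, iff_false]
    exact hp.compl

/-- The double-sample event: some set of the class avoids the first halves of the pairs and contains
at least `r` of the second halves. -/
def doubleSampleEvent {X J ι : Type*} [Fintype ι] (a : X → J → ι → ℝ) (𝓕 : Set (Set J))
    (s r : ℕ) : Set (Fin s → X × X) :=
  {z | ∃ θ, (∀ i, (z i).1 ∉ signClass a 𝓕 θ) ∧
    ∃ I : Finset (Fin s), r ≤ I.card ∧ ∀ i ∈ I, (z i).2 ∈ signClass a 𝓕 θ}

/-- The functionals of the elements of a family of pairs. -/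
def pairFunctionals {X J ι : Type*} (a : X → J → ι → ℝ) {s : ℕ} (z : Fin s → X × X) :
    (Fin s × Bool) × J → ι → ℝ :=
  fun k => a (if k.1.2 then (z k.1.1).2 else (z k.1.1).1) k.2

theorem measurableSet_doubleSampleEvent {X J ι : Type*} [MeasurableSpace X] [Fintype J] [Fintype ι]
    {a : X → J → ι → ℝ} (ha : Measurable a) (𝓕 : Set (Set J)) (s r : ℕ) :
    MeasurableSet (doubleSampleEvent a 𝓕 s r) := by
  have hb : Measurable (pairFunctionals (s := s) a) := by
    refine measurable_pi_iff.2 fun k => ?_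
    obtain ⟨⟨i, b⟩, j⟩ := k
    have haj : Measurable fun x => a x j := (measurable_pi_apply j).comp ha
    cases b
    · exact haj.comp (measurable_fst.comp (measurable_pi_apply i))
    · exact haj.comp (measurable_snd.comp (measurable_pi_apply i))
  exact measurableSet_exists_signs_mem hb
    {S | (∀ i, {j | ((i, false), j) ∈ S} ∉ 𝓕) ∧
      ∃ I : Finset (Fin s), r ≤ I.card ∧ ∀ i ∈ I, {j | ((i, true), j) ∈ S} ∈ 𝓕}

/-- Exchange the elements of the pairs selected by `σ`. -/
def swapPairs {X : Type*} {s : ℕ} (σ : Fin s → Bool) (z : Fin s → X × X) : Fin s → X × X :=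
  fun i => if σ i then (z i).swap else z i

theorem measurePreserving_swapPairs {X : Type*} [MeasurableSpace X] (ν : Measure X)
    [IsProbabilityMeasure ν] {s : ℕ} (σ : Fin s → Bool) :
    MeasurePreserving (swapPairs (X := X) σ) (Measure.pi fun _ => ν.prod ν)
      (Measure.pi fun _ => ν.prod ν) := by
  refine measurePreserving_pi (fun _ => ν.prod ν) (fun _ => ν.prod ν)
    (f := fun i p => if σ i then p.swap else p) fun i => ?_
  cases σ i
  · exact MeasurePreserving.id _
  · simpa using Measure.measurePreserving_swap

-- For fixed pairs the class matters only through the sign patterns on the 2s points, so a union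
-- bound over patterns reduces the count to one fixed set, where `card_choices_avoiding_mul_le`
-- applies.
open Classical in
theorem card_swaps_mem_doubleSampleEvent_mul_le {X J ι : Type*} [Fintype J] [Fintype ι]
    (a : X → J → ι → ℝ) (𝓕 : Set (Set J)) {s : ℕ} (r : ℕ) (z : Fin s → X × X) :
    (Finset.univ.filter fun σ => swapPairs σ z ∈ doubleSampleEvent a 𝓕 s r).card * 2 ^ r ≤
      (2 * s * Fintype.card J + 1) ^ Fintype.card ι * 2 ^ s := by
  let B : Finset ((Fin s × Bool) × J) → Fin s → Bool → Prop :=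
    fun S i b => {j | ((i, b), j) ∈ S} ∈ 𝓕
  let T : Finset ((Fin s × Bool) × J) → Finset (Fin s → Bool) := fun S =>
    Finset.univ.filter fun σ => (∀ i, ¬ B S i (σ i)) ∧
      ∃ I : Finset (Fin s), r ≤ I.card ∧ ∀ i ∈ I, B S i (!σ i)
  have hsub : (Finset.univ.filter fun σ => swapPairs σ z ∈ doubleSampleEvent a 𝓕 s r) ⊆
      (signPatterns (pairFunctionals a z)).biUnion T := by
    intro σ hσ
    obtain ⟨θ, h1, I, hI, h2⟩ := (Finset.mem_filter.1 hσ).2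
    let S : Finset ((Fin s × Bool) × J) :=
      Finset.univ.filter fun k => 0 < pairFunctionals a z k ⬝ᵥ θ
    have hS : ∀ i b, B S i b ↔ (if b then (z i).2 else (z i).1) ∈ signClass a 𝓕 θ := by
      intro i b
      have : {j | ((i, b), j) ∈ S} =
          {j | 0 < a (if b then (z i).2 else (z i).1) j ⬝ᵥ θ} := by
        ext j
        change ((i, b), j) ∈ S ↔ _
        rw [Finset.mem_filter]
        simp [pairFunctionals]
      change {j | ((i, b), j) ∈ S} ∈ 𝓕 ↔ _
      rw [this]
      rfl
    refine Finset.mem_biUnion.2 ⟨S, mem_signPatterns.2 ⟨θ, fun k => by simp [S]⟩,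
      Finset.mem_filter.2 ⟨Finset.mem_univ _, fun i => ?_, I, hI, fun i hi => ?_⟩⟩
    · rw [hS]
      have := h1 i
      cases h : σ i <;> simpa [swapPairs, h] using this
    · rw [hS]
      have := h2 i hi
      cases h : σ i <;> simpa [swapPairs, h] using this
  calc _ ≤ (∑ S ∈ signPatterns (pairFunctionals a z), (T S).card) * 2 ^ r :=
        Nat.mul_le_mul_right _ ((Finset.card_le_card hsub).trans Finset.card_biUnion_le)
    _ = ∑ S ∈ signPatterns (pairFunctionals a z), (T S).card * 2 ^ r := Finset.sum_mul ..
    _ ≤ ∑ S ∈ signPatterns (pairFunctionals a z), 2 ^ s :=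
        Finset.sum_le_sum fun S _ => card_choices_avoiding_mul_le (B S) r _ fun σ hσ =>
          (Finset.mem_filter.1 hσ).2
    _ = (signPatterns (pairFunctionals a z)).card * 2 ^ s := by simp
    _ ≤ _ := by
        refine Nat.mul_le_mul_right _ ((card_signPatterns_le _).trans (le_of_eq ?_))
        simp
        ring

/-- Swapping within pairs preserves the law, so the probability is the mean over samples of the
fraction of swaps that put the sample in the event, and this fraction is bounded pointwise. -/
theorem measure_doubleSampleEvent_mul_le {X J ι : Type*} [MeasurableSpace X] [Fintype J]
    [Fintype ι] (ν : Measure X) [IsProbabilityMeasure ν] {a : X → J → ι → ℝ} (ha : Measurable a)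
    (𝓕 : Set (Set J)) (s r : ℕ) :
    (Measure.pi fun _ : Fin s => ν.prod ν) (doubleSampleEvent a 𝓕 s r) * 2 ^ r ≤
      (2 * s * Fintype.card J + 1) ^ Fintype.card ι := by
  classical
  set D := doubleSampleEvent a 𝓕 s r
  set π := Measure.pi fun _ : Fin s => ν.prod ν
  have hD : MeasurableSet D := measurableSet_doubleSampleEvent ha 𝓕 s r
  have hσ : ∀ σ, π D = ∫⁻ z, D.indicator 1 (swapPairs σ z) ∂π := fun σ => by
    have hp := measurePreserving_swapPairs ν σ
    rw [hp.lintegral_comp (measurable_one.indicator hD), lintegral_indicator_one hD]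
  have hm : ∀ σ : Fin s → Bool, Measurable fun z : Fin s → X × X =>
      D.indicator (1 : (Fin s → X × X) → ENNReal) (swapPairs σ z) := fun σ =>
    (measurable_one.indicator hD).comp (measurePreserving_swapPairs ν σ).measurable
  have hsum : 2 ^ s * π D = ∫⁻ z, ∑ σ, D.indicator 1 (swapPairs σ z) ∂π := by
    rw [lintegral_finsetSum _ fun σ _ => hm σ]
    simp_rw [← hσ]
    simp
  have hkey : 2 ^ s * π D * 2 ^ r ≤
      2 ^ s * ((2 * s * Fintype.card J + 1) ^ Fintype.card ι : ENNReal) := by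
    rw [hsum, ← lintegral_mul_const _ (Finset.measurable_sum _ fun σ _ => hm σ)]
    calc _ ≤ ∫⁻ _, 2 ^ s * ((2 * s * Fintype.card J + 1) ^ Fintype.card ι : ENNReal) ∂π := by
          refine lintegral_mono fun z => ?_
          have h := card_swaps_mem_doubleSampleEvent_mul_le a 𝓕 r z
          have h' : (∑ σ, D.indicator (1 : (Fin s → X × X) → ENNReal) (swapPairs σ z)) =
              (Finset.univ.filter fun σ => swapPairs σ z ∈ D).card := by
            simp [Set.indicator_apply]
          dsimp only
          rw [h', mul_comm (2 ^ s : ENNReal)]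
          exact_mod_cast h
      _ = _ := by simp
  rw [mul_assoc] at hkey
  exact (ENNReal.mul_le_mul_iff_right (by positivity) (by simp)).1 hkey

/-- A sample of size `s` contains at least half of the expected number of elements of `A` with
probability at least half of the probability of `A`. -/
theorem half_le_measure_half_mean_le_card {X : Type*} [MeasurableSpace X] (ν : Measure X)
    [IsProbabilityMeasure ν] {A : Set X} (hA : MeasurableSet A) {η : ℝ} (hη : 0 < η)
    (hηA : η < ν.real A) {s : ℕ} (hs : 1 ≤ s) :
    ENNReal.ofReal (η / 2) ≤ (Measure.pi fun _ : Fin s => ν)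
      {z | ∃ I : Finset (Fin s), ⌈η * s / 2⌉₊ ≤ I.card ∧ ∀ i ∈ I, z i ∈ A} := by
  classical
  set π := Measure.pi fun _ : Fin s => ν
  let f : (Fin s → X) → ENNReal := fun z => ∑ i, A.indicator 1 (z i)
  have hfi : ∀ i : Fin s, Measurable fun z : Fin s → X => A.indicator (1 : X → ENNReal) (z i) :=
    fun i => (measurable_one.indicator hA).comp (measurable_pi_apply i)
  have hf : Measurable f := Finset.measurable_sum _ fun i _ => hfi i
  have hint : ∫⁻ z, f z ∂π = s * ν A := by
    rw [lintegral_finsetSum _ fun i _ => hfi i]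
    have : ∀ i : Fin s, ∫⁻ z : Fin s → X, A.indicator (1 : X → ENNReal) (z i) ∂π = ν A :=
      fun i => by
        rw [(measurePreserving_eval (fun _ : Fin s => ν) i).lintegral_comp
          (measurable_one.indicator hA), lintegral_indicator_one hA]
    simp [this]
  have hcard : ∀ z, f z = (Finset.univ.filter fun i => z i ∈ A).card := fun z => by
    simp [f, Set.indicator_apply]
  set G := {z | ENNReal.ofReal (η * s / 2) ≤ f z}
  have hG : MeasurableSet G := measurableSet_le measurable_const hf
  have hGsub : G ⊆ {z | ∃ I : Finset (Fin s), ⌈η * s / 2⌉₊ ≤ I.card ∧ ∀ i ∈ I, z i ∈ A} := by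
    intro z hz
    refine ⟨Finset.univ.filter fun i => z i ∈ A, ?_, by simp⟩
    have hz' : ENNReal.ofReal (η * s / 2) ≤ f z := hz
    rw [hcard, ENNReal.ofReal_le_natCast] at hz'
    exact Nat.ceil_le.2 hz'
  refine le_trans ?_ (measure_mono hGsub)
  -- Reverse Markov: the count is at most s on G and below ηs/2 off G.
  have hle : (s : ENNReal) * ν A ≤ s * π G + ENNReal.ofReal (η * s / 2) := by
    rw [← hint]
    calc ∫⁻ z, f z ∂π ≤ ∫⁻ z, (G.indicator (fun _ => (s : ENNReal)) z +
          ENNReal.ofReal (η * s / 2)) ∂π := by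
          refine lintegral_mono fun z => ?_
          by_cases hz : z ∈ G
          · refine le_add_right ?_
            rw [Set.indicator_of_mem hz, hcard]
            exact_mod_cast (Finset.card_le_univ _).trans (by simp)
          · refine le_add_left ?_
            exact (not_le.1 hz).le
      _ = _ := by
          rw [lintegral_add_right _ measurable_const, lintegral_indicator_const hG]
          simp
  have hreal : s * ν.real A ≤ s * π.real G + η * s / 2 := by
    have h1 := ENNReal.toReal_mono (by finiteness) hle
    rw [ENNReal.toReal_add (by finiteness) (by finiteness), ENNReal.toReal_mul,
      ENNReal.toReal_mul, ENNReal.toReal_ofReal (by positivity)] at h1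
    simpa [Measure.real] using h1
  have hs' : (1 : ℝ) ≤ s := by exact_mod_cast hs
  have : η / 2 ≤ π.real G := by
    have h2 : (s : ℝ) * (η / 2) ≤ s * π.real G := by nlinarith
    exact le_of_mul_le_mul_left h2 (by linarith)
  exact (ENNReal.ofReal_le_iff_le_toReal (by finiteness)).2 this

/-- Uniform bound for the probability that a set of a class defined by signs of linear functionals
has probability more than `η` and contains no element of a sample. -/
theorem measureReal_exists_avoiding_signClass_mul_le {X J ι : Type*} [MeasurableSpace X] [Fintype J]
    [Fintype ι] (ν : Measure X) [IsProbabilityMeasure ν] {a : X → J → ι → ℝ} (ha : Measurable a)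
    (𝓕 : Set (Set J)) {s : ℕ} (hs : 1 ≤ s) {η : ℝ} (hη : 0 < η) :
    η / 2 * (Measure.pi fun _ : Fin s => ν).real
        {z | ∃ θ, (∀ i, z i ∉ signClass a 𝓕 θ) ∧ η < ν.real (signClass a 𝓕 θ)} *
      2 ^ ⌈η * s / 2⌉₊ ≤ (2 * s * Fintype.card J + 1) ^ Fintype.card ι := by
  set π := Measure.pi fun _ : Fin s => ν
  set r := ⌈η * s / 2⌉₊
  set D := doubleSampleEvent a 𝓕 s r
  have hD : MeasurableSet D := measurableSet_doubleSampleEvent ha 𝓕 s r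
  let e := MeasurableEquiv.arrowProdEquivProdArrow X X (Fin s)
  have hpres : MeasurePreserving e (Measure.pi fun _ : Fin s => ν.prod ν) (π.prod π) :=
    measurePreserving_arrowProdEquivProdArrow X X (Fin s) (fun _ => ν) (fun _ => ν)
  have hD' : MeasurableSet (e.symm ⁻¹' D) := e.symm.measurable hD
  have hDD' : (π.prod π) (e.symm ⁻¹' D) = (Measure.pi fun _ : Fin s => ν.prod ν) D := by
    rw [← hpres.measure_preimage_equiv]
    congr 1
  have hsub : {z | ∃ θ, (∀ i, z i ∉ signClass a 𝓕 θ) ∧ η < ν.real (signClass a 𝓕 θ)} ⊆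
      -- Given a bad first sample, an independent second sample hits the offending set often enough
      -- with probability at least η/2. Markov's inequality for this conditional probability then
      -- bounds the bad samples by the double-sample event.
      {z | ENNReal.ofReal (η / 2) ≤ π (Prod.mk z ⁻¹' (e.symm ⁻¹' D))} := by
    rintro z ⟨θ, hz, hθ⟩
    refine (half_le_measure_half_mean_le_card ν (measurableSet_signClass ha 𝓕 θ) hη hθ
      hs).trans (measure_mono ?_)
    rintro z' ⟨I, hI, hz'⟩
    exact ⟨θ, hz, I, hI, hz'⟩
  have hmarkov : ENNReal.ofReal (η / 2) *
      π {z | ∃ θ, (∀ i, z i ∉ signClass a 𝓕 θ) ∧ η < ν.real (signClass a 𝓕 θ)} ≤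
      (Measure.pi fun _ : Fin s => ν.prod ν) D := by
    refine (mul_le_mul_right (measure_mono hsub) _).trans ?_
    refine (mul_meas_ge_le_lintegral (measurable_measure_prodMk_left hD') _).trans ?_
    rw [← Measure.prod_apply hD', hDD']
  have hfin := (mul_le_mul_left hmarkov (2 ^ r)).trans
    (measure_doubleSampleEvent_mul_le ν ha 𝓕 s r)
  have hre := ENNReal.toReal_mono (by finiteness) hfin
  rw [ENNReal.toReal_mul, ENNReal.toReal_mul, ENNReal.toReal_ofReal (by positivity)] at hre
  have hcast : ((2 * s * Fintype.card J + 1 : ENNReal) ^ Fintype.card ι).toReal =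
      (2 * s * Fintype.card J + 1) ^ Fintype.card ι := by
    rw [show (2 * s * Fintype.card J + 1 : ENNReal) ^ Fintype.card ι =
      (((2 * s * Fintype.card J + 1) ^ Fintype.card ι : ℕ) : ENNReal) by push_cast; rfl]
    rw [ENNReal.toReal_natCast]
    push_cast
    rfl
  rw [hcast] at hre
  simpa [Measure.real] using hre

/-! ### The optimization problems and their dual distributions -/

/-- A function that is the maximum of finitely many affine functions and is bounded below attains
its minimum, and the minimum is certified by a convex combination of the affine functions. -/
theorem exists_isMinOn_and_dual_of_pieces {J ι : Type*} [Finite J] [Fintype ι] {f : (ι → ℝ) → ℝ}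
    {a : J → ι → ℝ} {b : J → ℝ} (hle : ∀ j μ, a j ⬝ᵥ μ + b j ≤ f μ)
    (hex : ∀ μ, ∃ j, f μ = a j ⬝ᵥ μ + b j) (hf : BddBelow (Set.range f)) :
    ∃ μ₀, IsMinOn f Set.univ μ₀ ∧ ∃ w : J → ℝ, (∀ j, 0 ≤ w j) ∧ ∑ᶠ j, w j = 1 ∧
      ∑ᶠ j, w j • a j = 0 ∧ ∑ᶠ j, w j * b j = f μ₀ := by
  have := Fintype.ofFinite J
  obtain ⟨c, hc⟩ := hf
  obtain ⟨μ₀, w, ⟨hw0, hw1⟩, hwa, hwb⟩ := exists_minimizer_and_dual_max_affine a b c fun μ => by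
    obtain ⟨j, hj⟩ := hex μ
    exact ⟨j, hj ▸ hc ⟨μ, rfl⟩⟩
  have hlow : ∀ μ, ∑ j, w j * b j ≤ f μ := by
    intro μ
    have h1 : ∑ j, w j * (a j ⬝ᵥ μ) = 0 := by
      have : (∑ j, w j • a j) ⬝ᵥ μ = 0 := by rw [hwa, zero_dotProduct]
      simpa [sum_dotProduct, smul_dotProduct] using this
    calc ∑ j, w j * b j = ∑ j, w j * (a j ⬝ᵥ μ + b j) := by
          simp [mul_add, Finset.sum_add_distrib, h1]
      _ ≤ ∑ j, w j * f μ :=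
          Finset.sum_le_sum fun j _ => mul_le_mul_of_nonneg_left (hle j μ) (hw0 j)
      _ = f μ := by rw [← Finset.sum_mul, hw1, one_mul]
  have hup : f μ₀ ≤ ∑ j, w j * b j := by
    obtain ⟨j, hj⟩ := hex μ₀
    exact hj.le.trans (hwb j)
  refine ⟨μ₀, fun μ _ => hup.trans (hlow μ), w, hw0, ?_, ?_, ?_⟩
  · rwa [finsum_eq_sum_of_fintype]
  · rwa [finsum_eq_sum_of_fintype]
  · rw [finsum_eq_sum_of_fintype]
    exact le_antisymm (hlow μ₀) hup

/-- The vector with components `± lam i`, with signs given by `σ`. -/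
def signedVec {m : ℕ} (lam : Fin m → ℝ) (σ : Fin m → Bool) : Fin m → ℝ :=
  fun i => if σ i then lam i else -lam i

theorem abs_signedVec_le {m : ℕ} {lam : Fin m → ℝ} (hlam : ∀ i, 0 ≤ lam i) (σ : Fin m → Bool)
    (i : Fin m) : |signedVec lam σ i| ≤ lam i := by
  unfold signedVec
  split_ifs <;> simp [abs_of_nonneg (hlam i)]

theorem signedVec_dotProduct_le {m : ℕ} {lam : Fin m → ℝ} (hlam : ∀ i, 0 ≤ lam i)
    (σ : Fin m → Bool) (μ : Fin m → ℝ) : signedVec lam σ ⬝ᵥ μ ≤ ∑ i, lam i * |μ i| := by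
  refine Finset.sum_le_sum fun i _ => (le_abs_self _).trans ?_
  rw [abs_mul]
  exact mul_le_mul_of_nonneg_right (abs_signedVec_le hlam σ i) (abs_nonneg _)

theorem exists_signedVec_dotProduct_eq {m : ℕ} (lam μ : Fin m → ℝ) :
    ∃ σ, signedVec lam σ ⬝ᵥ μ = ∑ i, lam i * |μ i| := by
  refine ⟨fun i => decide (0 ≤ μ i), Finset.sum_congr rfl fun i _ => ?_⟩
  by_cases h : 0 ≤ μ i
  · simp [signedVec, h, abs_of_nonneg h]
  · simp [signedVec, h, abs_of_neg (not_le.1 h)]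

/-- A finitely supported probability measure with given weights. -/
theorem exists_isProbabilityMeasure_integral_eq_sum {Z K : Type*} [MeasurableSpace Z]
    [MeasurableSingletonClass Z] [Fintype K] (w : K → ℝ) (hw : ∀ k, 0 ≤ w k) (hw1 : ∑ k, w k = 1)
    (z : K → Z) :
    ∃ p : Measure Z, IsProbabilityMeasure p ∧ ∀ f : Z → ℝ, ∫ x, f x ∂p = ∑ k, w k * f (z k) := by
  refine ⟨∑ k, ENNReal.ofReal (w k) • Measure.dirac (z k), ⟨?_⟩, fun f => ?_⟩
  · simp only [Measure.coe_finsetSum, Finset.sum_apply, Measure.smul_apply, measure_univ,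
      smul_eq_mul, mul_one]
    rw [← ENNReal.ofReal_sum_of_nonneg fun k _ => hw k, hw1, ENNReal.ofReal_one]
  · rw [integral_finsetSum_measure fun k _ =>
      (integrable_dirac (by simp)).smul_measure ENNReal.ofReal_ne_top]
    simp [integral_smul_measure, ENNReal.toReal_ofReal (hw _)]

namespace MRC

theorem nonempty_gap_set {X Y : Type*} [Nonempty Y] {m : ℕ} {Φ : X → Y → Fin m → ℝ} {S : Set X}
    {h : X → Y → ℝ} {μ : Fin m → ℝ} (hS' : S.Nonempty) :
    {v | ∃ x ∈ S, ∃ y, v = Φ x y ⬝ᵥ μ - h x y}.Nonempty := by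
  obtain ⟨x, hx⟩ := hS'
  exact ⟨_, x, hx, Classical.arbitrary Y, rfl⟩

section Optimization

variable {X Y : Type*} [Fintype Y] {m : ℕ} {Φ : X → Y → Fin m → ℝ} {S : Set X}
  {h : X → Y → ℝ} {τ lam μ : Fin m → ℝ}

theorem finite_phi_set (hS : S.Finite) : {v | ∃ x ∈ S, ∃ C : Finset Y, C.Nonempty ∧
    v = ((∑ y ∈ C, Φ x y ⬝ᵥ μ) - 1) / (C.card : ℝ)}.Finite := by
  refine ((hS.prod (Set.finite_univ (α := Finset Y))).image fun q =>
    ((∑ y ∈ q.2, Φ q.1 y ⬝ᵥ μ) - 1) / (q.2.card : ℝ)).subset ?_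
  rintro v ⟨x, hx, C, -, rfl⟩
  exact ⟨(x, C), ⟨hx, Set.mem_univ _⟩, rfl⟩

theorem le_phi (hS : S.Finite) {x : X} (hx : x ∈ S) {C : Finset Y} (hC : C.Nonempty) :
    ((∑ y ∈ C, Φ x y ⬝ᵥ μ) - 1) / (C.card : ℝ) ≤ phi Φ S μ :=
  le_csSup (finite_phi_set hS).bddAbove ⟨x, hx, C, hC, rfl⟩

theorem exists_phi_eq [Nonempty Y] (hS : S.Finite) (hS' : S.Nonempty) :
    ∃ x ∈ S, ∃ C : Finset Y, C.Nonempty ∧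
      phi Φ S μ = ((∑ y ∈ C, Φ x y ⬝ᵥ μ) - 1) / (C.card : ℝ) := by
  obtain ⟨x, hx⟩ := hS'
  refine Set.Nonempty.csSup_mem ?_ (finite_phi_set hS)
  exact ⟨_, x, hx, Finset.univ, Finset.univ_nonempty, rfl⟩

theorem finite_gap_set (hS : S.Finite) : {v | ∃ x ∈ S, ∃ y, v = Φ x y ⬝ᵥ μ - h x y}.Finite := by
  refine ((hS.prod (Set.finite_univ (α := Y))).image fun q =>
    Φ q.1 q.2 ⬝ᵥ μ - h q.1 q.2).subset ?_
  rintro v ⟨x, hx, y, rfl⟩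
  exact ⟨(x, y), ⟨hx, Set.mem_univ _⟩, rfl⟩

/-- The learning problem has a solution if its objective is bounded below, and its value is the
infimum of the risks under some distribution in the uncertainty set. -/
theorem exists_isMinOn_learnObj [MeasurableSpace X] [MeasurableSpace Y]
    [MeasurableSingletonClass X] [MeasurableSingletonClass Y] [Nonempty Y]
    (hS : S.Finite) (hS' : S.Nonempty) (hlam : ∀ i, 0 ≤ lam i)
    (hb : BddBelow (Set.range (learnObj Φ τ lam S))) :
    ∃ μ₀, IsMinOn (learnObj Φ τ lam S) Set.univ μ₀ ∧ ∃ p ∈ uncertaintySet Φ τ lam,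
      ∀ h : X → Y → ℝ, IsRule h → learnObj Φ τ lam S μ₀ ≤ risk p h := by
  classical
  have := hS.fintype
  -- Pieces of the objective: a sampled instance and a label set for φ, and a sign vector for `lamᵀ
  -- |μ|`.
  let J := S × {C : Finset Y // C.Nonempty} × (Fin m → Bool)
  let a : J → Fin m → ℝ := fun j =>
    -τ + (j.2.1.1.card : ℝ)⁻¹ • ∑ y ∈ j.2.1.1, Φ j.1 y + signedVec lam j.2.2
  let b : J → ℝ := fun j => 1 - (j.2.1.1.card : ℝ)⁻¹
  have hab : ∀ (j : J) μ, a j ⬝ᵥ μ + b j = 1 - τ ⬝ᵥ μ +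
      ((∑ y ∈ j.2.1.1, Φ j.1 y ⬝ᵥ μ) - 1) / (j.2.1.1.card : ℝ) + signedVec lam j.2.2 ⬝ᵥ μ := by
    intro j μ
    simp only [a, b, add_dotProduct, neg_dotProduct, smul_dotProduct, sum_dotProduct, smul_eq_mul,
      div_eq_mul_inv]
    ring
  obtain ⟨μ₀, hμ₀, w, hw0, hw1, hwa, hwb⟩ := exists_isMinOn_and_dual_of_pieces (a := a) (b := b)
    (f := learnObj Φ τ lam S)
    (fun j μ => by
      rw [hab, learnObj]
      have h1 := le_phi (Φ := Φ) (μ := μ) hS j.1.2 j.2.1.2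
      have h2 := signedVec_dotProduct_le hlam j.2.2 μ
      linarith)
    (fun μ => by
      obtain ⟨x, hx, C, hC, hphi⟩ := exists_phi_eq (Φ := Φ) (μ := μ) hS hS'
      obtain ⟨σ, hσ⟩ := exists_signedVec_dotProduct_eq lam μ
      refine ⟨(⟨x, hx⟩, ⟨C, hC⟩, σ), ?_⟩
      rw [hab, learnObj, hphi, hσ]) hb
  rw [finsum_eq_sum_of_fintype] at hw1 hwa hwb
  -- The dual weight of a piece is spread uniformly over its label set C at its instance. Zero total
  -- slope then becomes the moment constraint.
  let v : J × Y → ℝ := fun k => w k.1 * if k.2 ∈ k.1.2.1.1 then (k.1.2.1.1.card : ℝ)⁻¹ else 0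
  have hcard : ∀ j : J, (0 : ℝ) < j.2.1.1.card := fun j => by
    exact_mod_cast j.2.1.2.card_pos
  have hvsum : ∀ f : X × Y → ℝ, ∑ k, v k * f (k.1.1, k.2) =
      ∑ j, w j * ((j.2.1.1.card : ℝ)⁻¹ * ∑ y ∈ j.2.1.1, f (j.1, y)) := by
    intro f
    rw [Fintype.sum_prod_type]
    refine Finset.sum_congr rfl fun j _ => ?_
    simp only [v, mul_assoc]
    rw [← Finset.mul_sum, Finset.mul_sum (s := j.2.1.1)]
    simp [ite_mul, Finset.sum_ite_mem]
  have hv0 : ∀ k, 0 ≤ v k := fun k => by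
    refine mul_nonneg (hw0 _) ?_
    split_ifs
    · positivity
    · exact le_rfl
  have hv1 : ∑ k, v k = 1 := by
    have := hvsum fun _ => 1
    simp only [mul_one, Finset.sum_const, nsmul_eq_mul] at this
    rw [this, ← hw1]
    refine Finset.sum_congr rfl fun j _ => ?_
    rw [inv_mul_cancel₀ (hcard j).ne', mul_one]
  obtain ⟨p, hp, hpint⟩ := exists_isProbabilityMeasure_integral_eq_sum v hv0 hv1
    fun k => ((k.1.1 : X), k.2)
  refine ⟨μ₀, hμ₀, p, ⟨hp, fun i => ?_⟩, fun h hh => ?_⟩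
  · rw [hpint, hvsum fun z => Φ z.1 z.2 i]
    have h1 := congrFun hwa i
    simp only [a, Finset.sum_apply, Pi.smul_apply, Pi.add_apply, Pi.neg_apply, smul_eq_mul,
      Pi.zero_apply, mul_add, Finset.sum_add_distrib, ← Finset.sum_mul, hw1] at h1
    have h2 : (∑ j : J, w j * ((j.2.1.1.card : ℝ)⁻¹ * ∑ y ∈ j.2.1.1, Φ j.1 y i)) - τ i =
        -∑ j : J, w j * signedVec lam j.2.2 i := by linarith
    rw [h2, abs_neg]
    calc _ ≤ ∑ j : J, |w j * signedVec lam j.2.2 i| := Finset.abs_sum_le_sum_abs _ _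
      _ ≤ ∑ j : J, w j * lam i := by
          refine Finset.sum_le_sum fun j _ => ?_
          rw [abs_mul, abs_of_nonneg (hw0 j)]
          exact mul_le_mul_of_nonneg_left (abs_signedVec_le hlam _ i) (hw0 j)
      _ = lam i := by rw [← Finset.sum_mul, hw1, one_mul]
  · rw [risk, hpint, hvsum fun z => 1 - h z.1 z.2, ← hwb]
    refine Finset.sum_le_sum fun j _ => mul_le_mul_of_nonneg_left ?_ (hw0 j)
    simp only [Finset.sum_sub_distrib, Finset.sum_const, nsmul_eq_mul, mul_one, mul_sub, b]
    rw [inv_mul_cancel₀ (hcard j).ne']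
    -- A rule puts mass at most 1 on C, so its error averaged over C is at least 1 - 1/|C|, the
    -- constant term of the piece.
    have h1 : ∑ y ∈ j.2.1.1, h j.1 y ≤ 1 := by
      rw [← (hh.mem_simplex j.1).2]
      exact Finset.sum_le_sum_of_subset_of_nonneg (Finset.subset_univ _)
        fun y _ _ => (hh.mem_simplex j.1).1 y
    have h2 := mul_le_mul_of_nonneg_left h1 (inv_nonneg.2 (hcard j).le)
    linarith

theorem exists_isRule (X Y : Type*) [MeasurableSpace X] [Fintype Y] [Nonempty Y] :
    ∃ h : X → Y → ℝ, IsRule h :=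
  ⟨fun _ _ => (Fintype.card Y : ℝ)⁻¹, fun _ => measurable_const,
    fun _ => ⟨fun _ => by positivity, by simp⟩⟩

theorem IsRule.le_one [MeasurableSpace X] (hh : IsRule h) (x : X) (y : Y) : h x y ≤ 1 := by
  rw [← (hh.mem_simplex x).2]
  exact Finset.single_le_sum (fun y _ => (hh.mem_simplex x).1 y) (Finset.mem_univ y)

theorem risk_le_one [MeasurableSpace X] [MeasurableSpace Y] (p : Measure (X × Y))
    [IsProbabilityMeasure p] (hh : IsRule h) : risk p h ≤ 1 := by
  refine (le_abs_self _).trans ?_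
  have := norm_integral_le_of_norm_le_const (μ := p) (C := 1) (f := fun z => 1 - h z.1 z.2)
    (Filter.Eventually.of_forall fun z => by
      rw [Real.norm_eq_abs, abs_le]
      have h1 := hh.le_one z.1 z.2
      have h2 := (hh.mem_simplex z.1).1 z.2
      constructor <;> linarith)
  rwa [probReal_univ, mul_one, Real.norm_eq_abs] at this

theorem le_minimaxRisk [MeasurableSpace X] [MeasurableSpace Y] [Nonempty Y]
    {U : Set (Measure (X × Y))} (hU : ∀ p ∈ U, IsProbabilityMeasure p) {p : Measure (X × Y)}
    (hp : p ∈ U) {v : ℝ} (hv : ∀ h : X → Y → ℝ, IsRule h → v ≤ risk p h) : v ≤ minimaxRisk U := by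
  obtain ⟨h₀, hh₀⟩ := exists_isRule X Y
  refine le_csInf ⟨_, h₀, hh₀, rfl⟩ ?_
  rintro _ ⟨h, hh, rfl⟩
  refine (hv h hh).trans (le_csSup ⟨1, ?_⟩ ⟨p, hp, rfl⟩)
  rintro _ ⟨q, hq, rfl⟩
  have := hU q hq
  exact risk_le_one q hh

/-- Finiteness is inherited from the learning problem: averaging over the label set that attains φ,
with h ≤ 1, bounds φ(μ) by the maximal gap plus 1. -/
theorem exists_isMinOn_upperObj [Nonempty Y] (hS : S.Finite) (hS' : S.Nonempty)
    (hlam : ∀ i, 0 ≤ lam i) (hh : ∀ x y, h x y ≤ 1)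
    (hb : BddBelow (Set.range (learnObj Φ τ lam S))) :
    ∃ μ₀, IsMinOn (upperObj Φ τ lam S h) Set.univ μ₀ := by
  have := hS.to_subtype
  let a : S × Y × (Fin m → Bool) → Fin m → ℝ := fun j =>
    -τ + Φ j.1 j.2.1 + signedVec lam j.2.2
  have hab : ∀ j μ, a j ⬝ᵥ μ + (1 - h j.1 j.2.1) =
      1 - τ ⬝ᵥ μ + (Φ j.1 j.2.1 ⬝ᵥ μ - h j.1 j.2.1) + signedVec lam j.2.2 ⬝ᵥ μ := by
    intro j μ
    simp only [a, add_dotProduct, neg_dotProduct]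
    ring
  obtain ⟨μ₀, hμ₀, -⟩ := exists_isMinOn_and_dual_of_pieces (a := a)
    (b := fun j => 1 - h j.1 j.2.1) (f := upperObj Φ τ lam S h)
    (fun j μ => by
      rw [hab, upperObj]
      have h1 := le_csSup (finite_gap_set (Φ := Φ) (h := h) (μ := μ) hS).bddAbove
        ⟨j.1, j.1.2, j.2.1, rfl⟩
      have h2 := signedVec_dotProduct_le hlam j.2.2 μ
      linarith)
    (fun μ => by
      obtain ⟨x, hx, y, hxy⟩ := (nonempty_gap_set (Φ := Φ) (h := h) (μ := μ) hS').csSup_mem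
        (finite_gap_set hS)
      obtain ⟨σ, hσ⟩ := exists_signedVec_dotProduct_eq lam μ
      refine ⟨(⟨x, hx⟩, y, σ), ?_⟩
      rw [hab, upperObj, hxy, hσ])
    (by
      obtain ⟨c, hc⟩ := hb
      refine ⟨c - 1, ?_⟩
      rintro _ ⟨μ, rfl⟩
      have h1 : c ≤ learnObj Φ τ lam S μ := hc ⟨μ, rfl⟩
      obtain ⟨x, hx, C, hC, hphi⟩ := exists_phi_eq (Φ := Φ) (μ := μ) hS hS'
      have hCpos : (0 : ℝ) < C.card := by exact_mod_cast hC.card_pos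
      rw [learnObj, hphi] at h1
      rw [upperObj]
      set M := sSup {v | ∃ x ∈ S, ∃ y, v = Φ x y ⬝ᵥ μ - h x y}
      have h2 : ∑ y ∈ C, Φ x y ⬝ᵥ μ ≤ C.card * (M + 1) := by
        rw [← nsmul_eq_mul]
        refine Finset.sum_le_card_nsmul _ _ _ fun y _ => ?_
        have h3 : Φ x y ⬝ᵥ μ - h x y ≤ M := le_csSup (finite_gap_set hS).bddAbove ⟨x, hx, y, rfl⟩
        have := hh x y
        linarith
      have h4 : ((∑ y ∈ C, Φ x y ⬝ᵥ μ) - 1) / (C.card : ℝ) ≤ M + 1 := by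
        rw [div_le_iff₀ hCpos]
        linarith
      linarith)
  exact ⟨μ₀, hμ₀⟩

/-- The negated objective at μ is compared with the learning objective at -μ: since h ≥ 0, φ(-μ) is
at most minus the minimal gap, and the constants 1 and -1 account for the loss of 2. -/
theorem exists_isMaxOn_lowerObj [Nonempty Y] (hS : S.Finite) (hS' : S.Nonempty)
    (hlam : ∀ i, 0 ≤ lam i) (hh : ∀ x y, 0 ≤ h x y)
    (hb : BddBelow (Set.range (learnObj Φ τ lam S))) :
    ∃ μ₀, IsMaxOn (lowerObj Φ τ lam S h) Set.univ μ₀ := by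
  have := hS.to_subtype
  let a : S × Y × (Fin m → Bool) → Fin m → ℝ := fun j =>
    τ - Φ j.1 j.2.1 + signedVec lam j.2.2
  have hab : ∀ j μ, a j ⬝ᵥ μ + (h j.1 j.2.1 - 1) =
      -(1 - τ ⬝ᵥ μ + (Φ j.1 j.2.1 ⬝ᵥ μ - h j.1 j.2.1) - signedVec lam j.2.2 ⬝ᵥ μ) := by
    intro j μ
    simp only [a, add_dotProduct, sub_dotProduct]
    ring
  obtain ⟨μ₀, hμ₀, -⟩ := exists_isMinOn_and_dual_of_pieces (a := a)
    (b := fun j => h j.1 j.2.1 - 1) (f := fun μ => -lowerObj Φ τ lam S h μ)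
    (fun j μ => by
      rw [hab, lowerObj]
      have h1 := csInf_le (finite_gap_set (Φ := Φ) (h := h) (μ := μ) hS).bddBelow
        ⟨j.1, j.1.2, j.2.1, rfl⟩
      have h2 := signedVec_dotProduct_le hlam j.2.2 μ
      linarith)
    (fun μ => by
      obtain ⟨x, hx, y, hxy⟩ := (nonempty_gap_set (Φ := Φ) (h := h) (μ := μ) hS').csInf_mem
        (finite_gap_set hS)
      obtain ⟨σ, hσ⟩ := exists_signedVec_dotProduct_eq lam μ
      refine ⟨(⟨x, hx⟩, y, σ), ?_⟩
      rw [hab, lowerObj, hxy, hσ])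
    (by
      obtain ⟨c, hc⟩ := hb
      refine ⟨c - 2, ?_⟩
      rintro _ ⟨μ, rfl⟩
      have h1 : c ≤ learnObj Φ τ lam S (-μ) := hc ⟨-μ, rfl⟩
      obtain ⟨x, hx, C, hC, hphi⟩ := exists_phi_eq (Φ := Φ) (μ := -μ) hS hS'
      have hCpos : (0 : ℝ) < C.card := by exact_mod_cast hC.card_pos
      rw [learnObj, hphi] at h1
      simp only [lowerObj]
      set M := sInf {v | ∃ x ∈ S, ∃ y, v = Φ x y ⬝ᵥ μ - h x y}
      have h2 : ∑ y ∈ C, Φ x y ⬝ᵥ (-μ) ≤ C.card * (-M) := by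
        rw [← nsmul_eq_mul]
        refine Finset.sum_le_card_nsmul _ _ _ fun y _ => ?_
        have h3 : M ≤ Φ x y ⬝ᵥ μ - h x y := csInf_le (finite_gap_set hS).bddBelow ⟨x, hx, y, rfl⟩
        have := hh x y
        rw [dotProduct_neg]
        linarith
      have h4 : ((∑ y ∈ C, Φ x y ⬝ᵥ (-μ)) - 1) / (C.card : ℝ) ≤ -M := by
        rw [div_le_iff₀ hCpos]
        linarith
      simp only [dotProduct_neg, Pi.neg_apply, abs_neg] at h1 h4
      linarith)
  exact ⟨μ₀, by simpa using hμ₀.neg⟩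

theorem isRule_mrcRule [MeasurableSpace X] [Nonempty Y] (hΦ : ∀ y, Measurable fun x => Φ x y)
    (S : Set X) (μ : Fin m → ℝ) : IsRule (mrcRule Φ S μ) := by
  classical
  have hu : ∀ y, Measurable fun x => max (Φ x y ⬝ᵥ μ - phi Φ S μ) 0 := fun y => by
    have : Measurable fun x => Φ x y ⬝ᵥ μ := by
      unfold dotProduct
      have := hΦ y
      fun_prop
    exact (this.sub_const _).max measurable_const
  have hc : Measurable fun x => ∑ y, max (Φ x y ⬝ᵥ μ - phi Φ S μ) 0 :=
    Finset.measurable_sum _ fun y _ => hu y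
  refine ⟨fun y => ?_, fun x => ⟨fun y => ?_, ?_⟩⟩
  · unfold mrcRule
    exact Measurable.ite (hc (measurableSet_singleton 0)) measurable_const ((hu y).div hc)
  · unfold mrcRule
    split_ifs
    · positivity
    · exact div_nonneg (le_max_right _ _) (Finset.sum_nonneg fun _ _ => le_max_right _ _)
  · unfold mrcRule
    split_ifs with h0
    · simp
    · rw [← Finset.sum_div, div_self h0]

/-- On the instances in `S`, the rule dominates the unnormalized values. -/
theorem sub_phi_le_mrcRule (hS : S.Finite) {x : X} (hx : x ∈ S) (y : Y) :
    Φ x y ⬝ᵥ μ - phi Φ S μ ≤ mrcRule Φ S μ x y := by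
  classical
  set u : Y → ℝ := fun y => Φ x y ⬝ᵥ μ - phi Φ S μ
  have hu0 : ∀ y, 0 ≤ max (u y) 0 := fun y => le_max_right _ _
  change u y ≤ _
  unfold mrcRule
  split_ifs with h0
  · have h1 := (Finset.sum_eq_zero_iff_of_nonneg fun y _ => hu0 y).1 h0 y (Finset.mem_univ y)
    have h2 : u y ≤ 0 := max_eq_right_iff.1 h1
    exact h2.trans (by positivity)
  · have hpos : 0 < ∑ y, max (u y) 0 :=
      lt_of_le_of_ne (Finset.sum_nonneg fun y _ => hu0 y) (Ne.symm h0)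
    -- This is the defining inequality of φ for the set of labels with positive u. Normalizing
    -- therefore only increases the positive parts.
    have hle : ∑ y, max (u y) 0 ≤ 1 := by
      let C : Finset Y := Finset.univ.filter fun y => 0 < u y
      have hsum : ∑ y, max (u y) 0 = ∑ y ∈ C, u y := by
        rw [Finset.sum_filter]
        refine Finset.sum_congr rfl fun y _ => ?_
        split_ifs with h
        · exact max_eq_left h.le
        · exact max_eq_right (not_lt.1 h)
      have hC : C.Nonempty := by
        rw [Finset.nonempty_iff_ne_empty]
        intro hC
        rw [hsum, hC, Finset.sum_empty] at hpos
        exact lt_irrefl _ hpos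
      have hCpos : (0 : ℝ) < C.card := by exact_mod_cast hC.card_pos
      have h1 := le_phi (Φ := Φ) (μ := μ) hS hx hC
      rw [div_le_iff₀ hCpos] at h1
      rw [hsum]
      simp only [u, Finset.sum_sub_distrib, Finset.sum_const, nsmul_eq_mul]
      linarith
    refine (le_max_left (u y) 0).trans ?_
    rw [le_div_iff₀ hpos]
    exact mul_le_of_le_one_right (hu0 y) hle

theorem upperObj_mrcRule_le_learnObj [Nonempty Y] (hS : S.Finite) (hS' : S.Nonempty) :
    upperObj Φ τ lam S (mrcRule Φ S μ) μ ≤ learnObj Φ τ lam S μ := by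
  have : sSup {v | ∃ x ∈ S, ∃ y, v = Φ x y ⬝ᵥ μ - mrcRule Φ S μ x y} ≤ phi Φ S μ := by
    refine csSup_le (nonempty_gap_set hS') ?_
    rintro _ ⟨x, hx, y, rfl⟩
    have := sub_phi_le_mrcRule (Φ := Φ) (μ := μ) hS hx y
    linarith
  unfold upperObj learnObj
  linarith

end Optimization

end MRC

/-! ### Numerical estimates behind `epsilon` -/

theorem five_mul_mul_two_pow_le_exp (k : ℕ) : 5 * (k : ℝ) * 2 ^ k ≤ Real.exp (3 * k) := by
  have h1 : (20 : ℝ) ≤ Real.exp 3 := by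
    have h := Real.exp_one_gt_d9
    have : Real.exp 3 = Real.exp 1 ^ 3 := by rw [← Real.exp_nat_mul]; norm_num
    rw [this]
    calc (20 : ℝ) ≤ 2.7182818283 ^ 3 := by norm_num
      _ ≤ _ := by gcongr
  have h2 : 1 + (k : ℝ) * 9 ≤ (1 + 9) ^ k := one_add_mul_le_pow (by norm_num) k
  calc 5 * (k : ℝ) * 2 ^ k ≤ (1 + 9) ^ k * 2 ^ k := by
        gcongr
        have : (0 : ℝ) ≤ k := k.cast_nonneg
        linarith
    _ = 20 ^ k := by rw [← mul_pow]; norm_num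
    _ ≤ Real.exp 3 ^ k := by gcongr
    _ = Real.exp (3 * k) := by rw [← Real.exp_nat_mul]; ring_nf

/-- The left side is the base of the growth bound: 2s points, each with the k + k 2^k (s+1) + k
(s+1) functionals of `ruleFunctionals`. -/
theorem two_mul_mul_card_add_one_le_exp {k s : ℕ} (hk : 1 ≤ k) (hs : 7 ≤ s) :
    2 * (s : ℝ) * (k + (k * (2 ^ k * (s + 1)) + k * (s + 1))) + 1 ≤
      Real.exp (2 * Real.log s + 3 * k) := by
  have hs' : (7 : ℝ) ≤ s := by exact_mod_cast hs
  have hk' : (1 : ℝ) ≤ k := by exact_mod_cast hk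
  have h2 : (2 : ℝ) ≤ 2 ^ k := by
    calc (2 : ℝ) = 2 ^ 1 := by norm_num
      _ ≤ 2 ^ k := pow_le_pow_right₀ (by norm_num) hk
  have hexp : Real.exp (2 * Real.log s + 3 * k) = (s : ℝ) ^ 2 * Real.exp (3 * k) := by
    rw [Real.exp_add, two_mul, Real.exp_add, Real.exp_log (by linarith)]
    ring
  rw [hexp]
  refine le_trans ?_ (mul_le_mul_of_nonneg_left (five_mul_mul_two_pow_le_exp k) (by positivity))
  set q : ℝ := 2 ^ k
  have hkq : (k : ℝ) ≤ k * q / 2 := by nlinarith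
  have hkq1 : (2 : ℝ) ≤ k * q := by nlinarith
  have hsum : (k : ℝ) + (k * (q * (s + 1)) + k * (s + 1)) ≤ k * q * (2 * s) := by
    calc (k : ℝ) + (k * (q * (s + 1)) + k * (s + 1)) = k * (s + 2) + k * q * (s + 1) := by ring
      _ ≤ k * q / 2 * (s + 2) + k * q * (s + 1) := by gcongr
      _ = k * q * (3 / 2 * s + 2) := by ring
      _ ≤ k * q * (2 * s) := by
          gcongr
          linarith
  calc 2 * (s : ℝ) * (k + (k * (q * (s + 1)) + k * (s + 1))) + 1
      ≤ 2 * s * (k * q * (2 * s)) + 1 := by gcongr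
    _ = 4 * (k * q * s ^ 2) + 1 := by ring
    _ ≤ 4 * (k * q * s ^ 2) + k * q * s ^ 2 := by
        have : (1 : ℝ) ≤ s ^ 2 := one_le_pow₀ (by linarith)
        nlinarith
    _ = s ^ 2 * (5 * k * q) := by ring

/-- Here L and d stand for log s and log δ. With L ≥ 3 and k ≥ 1 the left side is at most 10 k (m+1)
L, and the terms 4 and -d inside B pay for d - 1. -/
theorem growth_exponent_le {k m L B d : ℝ} (hk : 1 ≤ k) (hm : 0 ≤ m) (hL : 3 ≤ L) (hd : 0 < -d)
    (hB : 4 + k * (m + 1) * L - d ≤ B) :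
    L + (2 * m + 3) * (2 * L + 3 * k) ≤ 10 * k ^ 2 * B + (d - 1) := by
  have hk2 : 1 ≤ k ^ 2 := one_le_pow₀ hk
  have hB0 : 0 ≤ B := by
    have : 0 ≤ k * (m + 1) * L := by positivity
    linarith
  have h1 : 10 * (4 + k * (m + 1) * L - d) ≤ 10 * k ^ 2 * B := by
    calc 10 * (4 + k * (m + 1) * L - d) ≤ 10 * 1 * B := by linarith
      _ ≤ _ := by gcongr
  have h2 : (m + 1) * (9 * k) ≤ (m + 1) * (3 * k * L) := by
    refine mul_le_mul_of_nonneg_left ?_ (by linarith)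
    nlinarith
  have h3 : (m + 1) * (7 * L) ≤ (m + 1) * (7 * k * L) := by
    refine mul_le_mul_of_nonneg_left ?_ (by linarith)
    nlinarith
  have h4 : L ≤ (m + 1) * L := by nlinarith
  have h5 : (2 * m + 3) * (2 * L + 3 * k) ≤ 3 * (m + 1) * (2 * L + 3 * k) :=
    mul_le_mul_of_nonneg_right (by linarith) (by positivity)
  linarith

namespace MRC

/-- The probability bound from the growth function, for `ε < 1`. -/
theorem le_half_of_mul_two_pow_le {k m s : ℕ} (hk : 1 ≤ k) (hs : 1 ≤ s) {δ : ℝ} (hδ : 0 < δ)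
    (hδ1 : δ < 1) (hε : epsilon k m δ s < 1) {p : ℝ} (hp : 0 ≤ p)
    (h : 5 / 6 * epsilon k m δ s / 2 * p * 2 ^ ⌈5 / 6 * epsilon k m δ s * s / 2⌉₊ ≤
      (2 * (s : ℝ) * (k + (k * (2 ^ k * (s + 1)) + k * (s + 1))) + 1) ^ (m + (m + 3))) :
    p ≤ δ / 2 := by
  have hs' : (1 : ℝ) ≤ s := by exact_mod_cast hs
  have hs0 : (0 : ℝ) < s := by linarith
  have hk' : (1 : ℝ) ≤ k := by exact_mod_cast hk
  have hm : (0 : ℝ) ≤ m := m.cast_nonneg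
  have hL0 : 0 ≤ Real.log s := Real.log_nonneg hs'
  have hlogk : -Real.log δ ≤ Real.log (k / δ) := by
    rw [Real.log_div (by linarith) hδ.ne']
    have := Real.log_nonneg hk'
    linarith
  have hlogδ : 0 < -Real.log δ := by
    have := Real.log_neg hδ hδ1
    linarith
  obtain ⟨L, hL⟩ : ∃ L, L = Real.log s := ⟨_, rfl⟩
  have hexpL : Real.exp L = s := by rw [hL, Real.exp_log hs0]
  simp only [epsilon, ← hL] at hε h hL0 ⊢
  set B : ℝ := 4 + k * (m + 1) * L + Real.log (k / δ) with hB
  have hkmL : 0 ≤ k * (m + 1) * L := by positivity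
  have hB4 : 4 ≤ B := by linarith
  set Q : ℝ := √(B / s) with hQdef
  have hQ2 : Q ^ 2 * s = B := by
    rw [hQdef, Real.sq_sqrt (by positivity)]
    field_simp
  have hQpos : 0 < Q := Real.sqrt_pos.2 (by positivity)
  -- The assumption ε < 1 says 6kQ < 1, and B = Q²s. It forces s to be at least 24, hence log s ≥ 3.
  have hQs : 6 * k * B ≤ Q * s := by
    rw [← hQ2]
    calc 6 * k * (Q ^ 2 * s) = 6 * k * Q * (Q * s) := by ring
      _ ≤ 1 * (Q * s) := by gcongr
      _ = Q * s := one_mul _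
  have hQ1 : Q ≤ 1 := by nlinarith
  have hs24 : 24 ≤ (s : ℝ) := by
    have h1 : Q * s ≤ s := by nlinarith
    have h2 : 6 * 1 * 4 ≤ 6 * k * B := by gcongr
    linarith
  have hL3 : 3 ≤ L := by
    rw [hL, Real.le_log_iff_exp_le hs0]
    have h := Real.exp_one_lt_d9
    have : Real.exp 3 = Real.exp 1 ^ 3 := by rw [← Real.exp_nat_mul]; norm_num
    rw [this]
    calc Real.exp 1 ^ 3 ≤ 2.7182818286 ^ 3 := by gcongr
      _ ≤ 24 := by norm_num
      _ ≤ s := hs24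
  have hcount := two_mul_mul_card_add_one_le_exp (s := s) hk (by
    have : (7 : ℝ) ≤ s := by linarith
    exact_mod_cast this)
  rw [← hL] at hcount
  have hN : (2 * (s : ℝ) * (k + (k * (2 ^ k * (s + 1)) + k * (s + 1))) + 1) ^ (m + (m + 3)) ≤
      Real.exp ((2 * m + 3) * (2 * L + 3 * k)) := by
    refine (pow_le_pow_left₀ (by positivity) hcount _).trans (le_of_eq ?_)
    rw [← Real.exp_nat_mul]
    push_cast
    congr 1
    ring
  -- The exponent of 2 is at least 15k²B, and log 2 ≥ 2/3.
  have hE : Real.exp (10 * k ^ 2 * B) ≤ 2 ^ ⌈5 / 6 * (6 * k * Q) * s / 2⌉₊ := by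
    have h1 : 15 * k ^ 2 * B ≤ 5 / 6 * (6 * k * Q) * s / 2 := by
      calc 15 * k ^ 2 * B = 5 / 2 * k * (6 * k * B) := by ring
        _ ≤ 5 / 2 * k * (Q * s) := by gcongr
        _ = _ := by ring
    have h2 := h1.trans (Nat.le_ceil _)
    have h3 := Real.log_two_gt_d9
    calc Real.exp (10 * k ^ 2 * B)
        ≤ Real.exp (⌈5 / 6 * (6 * k * Q) * s / 2⌉₊ * Real.log 2) := by
          rw [Real.exp_le_exp]
          calc 10 * k ^ 2 * B = 15 * k ^ 2 * B * (2 / 3) := by ring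
            _ ≤ ⌈5 / 6 * (6 * k * Q) * s / 2⌉₊ * Real.log 2 := by
                gcongr
                linarith
      _ = _ := by rw [Real.exp_nat_mul, Real.exp_log two_pos]
  have hη : 1 / s ≤ 5 / 6 * (6 * k * Q) / 2 := by
    rw [div_le_iff₀ hs0]
    have : 6 * 1 * 4 ≤ 6 * k * B := by gcongr
    have h1 : 1 ≤ Q * s := by linarith
    have h2 : 1 * 1 ≤ k * (Q * s) := by gcongr
    linarith
  have hmain : p * Real.exp (10 * k ^ 2 * B) ≤ Real.exp (L + (2 * m + 3) * (2 * L + 3 * k)) := by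
    rw [Real.exp_add, hexpL]
    have h1 : 1 / s * p * Real.exp (10 * k ^ 2 * B) ≤
        Real.exp ((2 * m + 3) * (2 * L + 3 * k)) := by
      refine le_trans ?_ (h.trans hN)
      gcongr
    calc p * Real.exp (10 * k ^ 2 * B) = s * (1 / s * p * Real.exp (10 * k ^ 2 * B)) := by
          field_simp
      _ ≤ _ := by gcongr
  have hexpo : L + (2 * m + 3) * (2 * L + 3 * k) ≤ 10 * k ^ 2 * B + (Real.log δ - 1) :=
    growth_exponent_le hk' hm hL3 hlogδ (by linarith)
  have hfin : p * Real.exp (10 * k ^ 2 * B) ≤ δ * Real.exp (-1) * Real.exp (10 * k ^ 2 * B) := by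
    refine hmain.trans ((Real.exp_le_exp.2 hexpo).trans (le_of_eq ?_))
    rw [Real.exp_add, Real.exp_sub, Real.exp_log hδ, Real.exp_neg]
    ring
  have h1 := le_of_mul_le_mul_right hfin (Real.exp_pos _)
  have h2 : Real.exp (-1) ≤ 1 / 2 := by
    rw [Real.exp_neg, ← one_div]
    have := Real.exp_one_gt_d9
    exact one_div_le_one_div_of_le two_pos (by linarith)
  nlinarith

theorem one_div_le_epsilon_div {k m s : ℕ} (hk : 1 ≤ k) (hs : 1 ≤ s) {δ : ℝ} (hδ : 0 < δ)
    (hδ1 : δ < 1) : 1 / (s : ℝ) ≤ epsilon k m δ s / 6 := by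
  have hs' : (1 : ℝ) ≤ s := by exact_mod_cast hs
  have hk' : (1 : ℝ) ≤ k := by exact_mod_cast hk
  have hL0 : 0 ≤ Real.log s := Real.log_nonneg hs'
  have hlog : 0 ≤ Real.log (k / δ) :=
    Real.log_nonneg ((one_le_div hδ).2 (hδ1.le.trans hk'))
  have hB : 1 ≤ 4 + k * (m + 1) * Real.log s + Real.log (k / δ) := by
    have : 0 ≤ k * (m + 1) * Real.log s := by positivity
    linarith
  have h1 : 1 / (s : ℝ) ≤ √((4 + k * (m + 1) * Real.log s + Real.log (k / δ)) / s) := by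
    refine Real.le_sqrt_of_sq_le ?_
    rw [div_pow, one_pow, div_le_div_iff₀ (by positivity) (by positivity)]
    nlinarith
  unfold epsilon
  have h2 : 0 ≤ √((4 + k * (m + 1) * Real.log s + Real.log (k / δ)) / s) := Real.sqrt_nonneg _
  nlinarith

end MRC

/-! ### Rules as sign classes -/

namespace MRC

section RuleClass

variable {X Y : Type*} {m : ℕ}

open Classical in
/-- The linear functionals of `(μ, μ', (φ, M, 1))` whose signs determine, at an instance `x`, the
labels with `Φ(x, y)ᵀ μ > φ`, the comparison of the rule with the multiples of `1 / s`, and that of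
`Φ(x, y)ᵀ μ' - M` with these multiples (with inequalities reversed if `e = -1`). -/
noncomputable def ruleFunctionals (Φ : X → Y → Fin m → ℝ) (s : ℕ) (e : ℝ) (x : X) :
    Y ⊕ ((Y × Finset Y × Fin (s + 1)) ⊕ (Y × Fin (s + 1))) → Fin m ⊕ (Fin m ⊕ Fin 3) → ℝ
  | .inl y => Sum.elim (Φ x y) (Sum.elim 0 ![-1, 0, 0])
  | .inr (.inl (y, T, j)) =>
      Sum.elim (e • ((if y ∈ T then Φ x y else 0) - ((j : ℕ) / s : ℝ) • ∑ y' ∈ T, Φ x y'))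
        (Sum.elim 0 ![-e * ((if y ∈ T then 1 else 0) - ((j : ℕ) / s : ℝ) * T.card), 0, 0])
  | .inr (.inr (y, j)) => Sum.elim 0 (Sum.elim (e • Φ x y) ![0, -e, -e * ((j : ℕ) / s : ℝ)])

open Classical in
/-- The sign patterns of `ruleFunctionals` such that `e h(y|x) ≤ e j / s` and
`e (Φ(x, y)ᵀ μ' - M - j / s) > 0` for some `y` and `j`. -/
def rulePatterns (Y : Type*) [Fintype Y] (s : ℕ) (e : ℝ) :
    Set (Set (Y ⊕ ((Y × Finset Y × Fin (s + 1)) ⊕ (Y × Fin (s + 1))))) :=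
  {B | ∃ (y : Y) (j : Fin (s + 1)), .inr (.inr (y, j)) ∈ B ∧
    if ∀ y', .inl y' ∉ B then e * (1 / (Fintype.card Y : ℝ)) ≤ e * ((j : ℕ) / s : ℝ)
    else .inr (.inl (y, Finset.univ.filter fun y' => .inl y' ∈ B, j)) ∉ B}

theorem mem_signClass_ruleFunctionals [Fintype Y] {Φ : X → Y → Fin m → ℝ} {s : ℕ} {e : ℝ} {S : Set X}
    {μ μ' : Fin m → ℝ} {M : ℝ} {x : X} :
    x ∈ signClass (ruleFunctionals Φ s e) (rulePatterns Y s e)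
        (Sum.elim μ (Sum.elim μ' ![phi Φ S μ, M, 1])) ↔
      ∃ (y : Y) (j : Fin (s + 1)), 0 < e * (Φ x y ⬝ᵥ μ' - M - ((j : ℕ) / s : ℝ)) ∧
        e * mrcRule Φ S μ x y ≤ e * ((j : ℕ) / s : ℝ) := by
  classical
  set θ : Fin m ⊕ (Fin m ⊕ Fin 3) → ℝ := Sum.elim μ (Sum.elim μ' ![phi Φ S μ, M, 1])
  set u : Y → ℝ := fun y => Φ x y ⬝ᵥ μ - phi Φ S μ with hu
  have h1 : ∀ y, ruleFunctionals Φ s e x (.inl y) ⬝ᵥ θ = u y := by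
    intro y
    simp only [ruleFunctionals, θ, sumElim_dotProduct_sumElim, hu]
    simp [dotProduct, Fin.sum_univ_three, sub_eq_add_neg]
  have h2 : ∀ y T j, ruleFunctionals Φ s e x (.inr (.inl (y, T, j))) ⬝ᵥ θ =
      e * ((if y ∈ T then u y else 0) - ((j : ℕ) / s : ℝ) * ∑ y' ∈ T, u y') := by
    intro y T j
    simp only [ruleFunctionals, θ, sumElim_dotProduct_sumElim, smul_dotProduct, sub_dotProduct,
      sum_dotProduct, smul_eq_mul, zero_dotProduct, hu, Finset.sum_sub_distrib, Finset.sum_const,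
      nsmul_eq_mul]
    split_ifs <;> simp [dotProduct, Fin.sum_univ_three] <;> ring
  have h3 : ∀ y j, ruleFunctionals Φ s e x (.inr (.inr (y, j))) ⬝ᵥ θ =
      e * (Φ x y ⬝ᵥ μ' - M - ((j : ℕ) / s : ℝ)) := by
    intro y j
    simp only [ruleFunctionals, θ, sumElim_dotProduct_sumElim, smul_dotProduct, zero_dotProduct,
      smul_eq_mul]
    simp [dotProduct, Fin.sum_univ_three]
    ring
  -- Once the set of labels with positive u is read off from the first signs, comparing the
  -- normalized value with j/s is linear after multiplication by the normalizer. If that set is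
  -- empty the rule is the constant 1/|Y|.
  simp only [signClass, rulePatterns, Set.mem_ofPred_eq, h1, h2, h3]
  refine exists_congr fun y => exists_congr fun j => and_congr_right fun _ => ?_
  have hsum : ∑ y', max (u y') 0 = ∑ y' ∈ Finset.univ.filter (fun y' => 0 < u y'), u y' := by
    rw [Finset.sum_filter]
    refine Finset.sum_congr rfl fun y' _ => ?_
    split_ifs with h
    · exact max_eq_left h.le
    · exact max_eq_right (not_lt.1 h)
  have hmax : (if y ∈ Finset.univ.filter (fun y' => 0 < u y') then u y else 0) = max (u y) 0 := by
    simp only [Finset.mem_filter, Finset.mem_univ, true_and]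
    split_ifs with h
    · exact (max_eq_left h.le).symm
    · exact (max_eq_right (not_lt.1 h)).symm
  have hzero : (∑ y', max (u y') 0 = 0) ↔ ∀ y', ¬ 0 < u y' := by
    rw [Finset.sum_eq_zero_iff_of_nonneg fun y _ => le_max_right _ _]
    simp
  have hrule : mrcRule Φ S μ x y = if ∑ y', max (u y') 0 = 0 then 1 / (Fintype.card Y : ℝ)
      else max (u y) 0 / ∑ y', max (u y') 0 := rfl
  by_cases h0 : ∀ y', ¬ 0 < u y'
  · rw [if_pos h0, hrule, if_pos (hzero.2 h0)]
  · rw [if_neg h0, hmax, ← hsum, hrule, if_neg fun h => h0 (hzero.1 h), not_lt]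
    have hpos : 0 < ∑ y', max (u y') 0 :=
      lt_of_le_of_ne (Finset.sum_nonneg fun y _ => le_max_right _ _)
        (Ne.symm fun h => h0 (hzero.1 h))
    set c := ∑ y', max (u y') 0
    have : e * (max (u y) 0 - ((j : ℕ) / s : ℝ) * c) =
        (e * (max (u y) 0 / c) - e * ((j : ℕ) / s : ℝ)) * c := by
      field_simp
    rw [this]
    constructor
    · intro h
      exact sub_nonpos.1 (nonpos_of_mul_nonpos_left h hpos)
    · intro h
      exact mul_nonpos_of_nonpos_of_nonneg (sub_nonpos.2 h) hpos.le

/-- Membership separates Φᵀμ' - M from h by a multiple of 1/s, so it implies that the gap is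
strictly beyond M. -/
theorem notMem_signClass_of_forall_le [Fintype Y] {Φ : X → Y → Fin m → ℝ} {s : ℕ} {e : ℝ} {S : Set X}
    {μ μ' : Fin m → ℝ} {M : ℝ} {x : X}
    (h : ∀ y, e * (Φ x y ⬝ᵥ μ' - mrcRule Φ S μ x y) ≤ e * M) :
    x ∉ signClass (ruleFunctionals Φ s e) (rulePatterns Y s e)
      (Sum.elim μ (Sum.elim μ' ![phi Φ S μ, M, 1])) := by
  rw [mem_signClass_ruleFunctionals]
  rintro ⟨y, j, h1, h2⟩
  have := h y
  linarith

theorem mem_signClass_of_lt [Fintype Y] [MeasurableSpace X] {Φ : X → Y → Fin m → ℝ} {s : ℕ} (hs : 1 ≤ s)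
    {e : ℝ} (he : e = 1 ∨ e = -1) {S : Set X} {μ μ' : Fin m → ℝ}
    (hrule : IsRule (mrcRule Φ S μ)) {M : ℝ} {x : X} {y : Y}
    (h : e * M + 1 / s < e * (Φ x y ⬝ᵥ μ' - mrcRule Φ S μ x y)) :
    x ∈ signClass (ruleFunctionals Φ s e) (rulePatterns Y s e)
      (Sum.elim μ (Sum.elim μ' ![phi Φ S μ, M, 1])) := by
  rw [mem_signClass_ruleFunctionals]
  have hs0 : (0 : ℝ) < s := by exact_mod_cast hs
  have h0 := (hrule.mem_simplex x).1 y
  have h1 := hrule.le_one x y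
  set v := mrcRule Φ S μ x y
  have hvs : v * s ≤ s := mul_le_of_le_one_left hs0.le h1
  -- Round the value of the rule to the grid, up for e = 1 and down for e = -1. Since it lies in [0,
  -- 1], the s + 1 grid points suffice.
  obtain ⟨j, hj1, hj2⟩ : ∃ j : Fin (s + 1), e * v ≤ e * ((j : ℕ) / s : ℝ) ∧
      e * ((j : ℕ) / s : ℝ) ≤ e * v + 1 / s := by
    rcases he with rfl | rfl
    · refine ⟨⟨⌈v * s⌉₊, Nat.lt_succ_of_le (Nat.ceil_le.2 hvs)⟩, ?_, ?_⟩
      · simp only [one_mul]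
        rw [le_div_iff₀ hs0]
        exact Nat.le_ceil _
      · simp only [one_mul]
        rw [div_le_iff₀ hs0, add_mul, one_div_mul_cancel hs0.ne']
        exact (Nat.ceil_lt_add_one (by positivity)).le
    · refine ⟨⟨⌊v * s⌋₊, Nat.lt_succ_of_le ?_⟩, ?_, ?_⟩
      · exact_mod_cast (Nat.floor_le (by positivity)).trans hvs
      · simp only [neg_mul, one_mul, neg_le_neg_iff]
        rw [div_le_iff₀ hs0]
        exact Nat.floor_le (by positivity)
      · have := Nat.lt_floor_add_one (v * s)
        have h3 : v ≤ (⌊v * s⌋₊ : ℝ) / s + 1 / s := by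
          rw [← add_div, le_div_iff₀ hs0]
          exact this.le
        simp only [neg_mul, one_mul]
        linarith
  exact ⟨y, j, by linarith, hj1⟩

theorem measurable_ruleFunctionals [MeasurableSpace X] {Φ : X → Y → Fin m → ℝ}
    (hΦ : ∀ y, Measurable fun x => Φ x y) (s : ℕ) (e : ℝ) :
    Measurable (ruleFunctionals Φ s e) := by
  classical
  have hΦ' : ∀ y i, Measurable fun x => Φ x y i := fun y i => (measurable_pi_apply i).comp (hΦ y)
  refine measurable_pi_iff.2 fun k => measurable_pi_iff.2 fun i => ?_
  obtain y | ⟨y, T, j⟩ | ⟨y, j⟩ := k <;> obtain i | i | i := i <;>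
    simp only [ruleFunctionals, Sum.elim_inl, Sum.elim_inr] <;> try exact measurable_const
  · exact hΦ' y i
  · simp only [Pi.smul_apply, Pi.sub_apply, Finset.sum_apply, smul_eq_mul]
    have := Finset.measurable_sum T fun y' _ => hΦ' y' i
    have h2 := hΦ' y i
    split_ifs
    · fun_prop
    · simp only [Pi.zero_apply]
      fun_prop
  · simp only [Pi.smul_apply, smul_eq_mul]
    exact (hΦ' y i).const_mul e

/-- With probability at least `1 - δ`, every set determined by a rule that contains no sample point
has small probability, provided that `ε < 1`. -/
theorem exists_exceptional_set [Fintype Y] [Nonempty Y] [MeasurableSpace X] {Φ : X → Y → Fin m → ℝ}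
    (hΦ : ∀ y, Measurable fun x => Φ x y) (ν : Measure X) [IsProbabilityMeasure ν]
    {Ω : Type*} [MeasurableSpace Ω] (P : Measure Ω) [IsProbabilityMeasure P] {s : ℕ} (hs : 1 ≤ s)
    (x : Fin s → Ω → X) (hx : ∀ i, Measurable (x i)) (hindep : iIndepFun x P)
    (hlaw : ∀ i, P.map (x i) = ν) {δ : ℝ} (hδ : 0 < δ) (hδ1 : δ < 1)
    (hε : epsilon (Fintype.card Y) m δ s < 1) :
    ∃ G : Set Ω, MeasurableSet G ∧ P.real G ≤ δ ∧ ∀ ω ∉ G, ∀ e : ℝ, (e = 1 ∨ e = -1) → ∀ θ,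
      (∀ i, x i ω ∉ signClass (ruleFunctionals Φ s e) (rulePatterns Y s e) θ) →
      ν.real (signClass (ruleFunctionals Φ s e) (rulePatterns Y s e) θ) ≤
        5 / 6 * epsilon (Fintype.card Y) m δ s := by
  have hk : 1 ≤ Fintype.card Y := Fintype.card_pos
  set η := 5 / 6 * epsilon (Fintype.card Y) m δ s with hη
  have hηpos : 0 < η := by
    have h1 := one_div_le_epsilon_div (m := m) hk hs hδ hδ1
    have h2 : (0 : ℝ) < 1 / s := by
      have : (0 : ℝ) < s := by exact_mod_cast hs
      positivity
    rw [hη]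
    linarith
  let V : ℝ → Set (Fin s → X) := fun e => {z | ∃ θ,
    (∀ i, z i ∉ signClass (ruleFunctionals Φ s e) (rulePatterns Y s e) θ) ∧
      η < ν.real (signClass (ruleFunctionals Φ s e) (rulePatterns Y s e) θ)}
  have hV : ∀ e, (Measure.pi fun _ : Fin s => ν).real (V e) ≤ δ / 2 := by
    intro e
    refine le_half_of_mul_two_pow_le hk hs hδ hδ1 hε measureReal_nonneg ?_
    have h := measureReal_exists_avoiding_signClass_mul_le ν
      (measurable_ruleFunctionals hΦ s e) (rulePatterns Y s e) hs hηpos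
    simpa using h
  have hmap : P.map (fun ω i => x i ω) = Measure.pi fun _ : Fin s => ν := by
    rw [(iIndepFun_iff_map_fun_eq_pi_map fun i => (hx i).aemeasurable).1 hindep]
    simp_rw [hlaw]
  have hxm : Measurable fun ω i => x i ω := measurable_pi_iff.2 hx
  have hW : ∀ e, P ((fun ω i => x i ω) ⁻¹' V e) ≤ ENNReal.ofReal (δ / 2) := by
    intro e
    refine (Measure.le_map_apply hxm.aemeasurable _).trans ?_
    rw [hmap, ← ofReal_measureReal]
    exact ENNReal.ofReal_le_ofReal (hV e)
  -- Each sign e costs δ/2. Replacing W by its measurable hull spares proving that it is measurable.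
  let W := ((fun ω i => x i ω) ⁻¹' V 1) ∪ ((fun ω i => x i ω) ⁻¹' V (-1))
  refine ⟨toMeasurable P W, measurableSet_toMeasurable P W, ?_, fun ω hω e he θ hθ => ?_⟩
  · refine ENNReal.toReal_le_of_le_ofReal hδ.le ?_
    rw [measure_toMeasurable]
    refine (measure_union_le _ _).trans ((add_le_add (hW 1) (hW (-1))).trans ?_)
    rw [← ENNReal.ofReal_add (by positivity) (by positivity), add_halves]
  · by_contra hlt
    refine hω (subset_toMeasurable P W ?_)
    rcases he with rfl | rfl
    · exact Or.inl ⟨θ, hθ, not_le.1 hlt⟩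
    · exact Or.inr ⟨θ, hθ, not_le.1 hlt⟩

end RuleClass

end MRC

/-! ### From small exceptional sets to risk bounds -/

theorem abs_dotProduct_le_mul_sum {ι : Type*} [Fintype ι] {v : ι → ℝ} {C : ℝ} (hv : ‖v‖ ≤ C)
    (μ : ι → ℝ) : |v ⬝ᵥ μ| ≤ C * ∑ i, |μ i| := by
  rw [Finset.mul_sum]
  refine (Finset.abs_sum_le_sum_abs _ _).trans (Finset.sum_le_sum fun i _ => ?_)
  rw [abs_mul]
  exact mul_le_mul_of_nonneg_right ((norm_le_pi_norm v i).trans hv) (abs_nonneg _)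

/-- The mean of a function of bounded range that exceeds `M + t` only over a set of small marginal
probability. -/
theorem integral_le_of_fst_measure_le {X Y : Type*} [MeasurableSpace X] [MeasurableSpace Y]
    (p : Measure (X × Y)) [IsProbabilityMeasure p] {g : X × Y → ℝ} (hg : Integrable g p)
    {A : Set X} (hA : MeasurableSet A) {M t r η : ℝ} (ht : 0 ≤ t) (hr : 0 ≤ r)
    (hpA : p.fst.real A ≤ η) (h1 : ∀ z, z.1 ∉ A → g z ≤ M + t) (h2 : ∀ z, g z ≤ M + r) :
    ∫ z, g z ∂p ≤ M + t + r * η := by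
  have hA' : MeasurableSet (Prod.fst ⁻¹' A : Set (X × Y)) := measurable_fst hA
  have hind : Integrable ((Prod.fst ⁻¹' A : Set (X × Y)).indicator fun _ => r) p :=
    (integrable_const r).indicator hA'
  calc ∫ z, g z ∂p ≤ ∫ z, (M + t + (Prod.fst ⁻¹' A : Set (X × Y)).indicator (fun _ => r) z) ∂p := by
        refine integral_mono hg ((integrable_const _).add hind) fun z => ?_
        by_cases hz : z.1 ∈ A
        · have : z ∈ (Prod.fst ⁻¹' A : Set (X × Y)) := hz
          simp only [Set.indicator_of_mem this]
          have := h2 z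
          linarith
        · have : z ∉ (Prod.fst ⁻¹' A : Set (X × Y)) := hz
          simp only [Set.indicator_of_notMem this, add_zero]
          exact h1 z hz
    _ = M + t + r * p.fst.real A := by
        rw [integral_add (integrable_const _) hind, integral_indicator_const _ hA',
          Measure.real, Measure.real, Measure.fst_apply hA]
        simp [mul_comm]
    _ ≤ _ := by gcongr

namespace MRC

section Generalization

variable {X Y : Type*} [Fintype Y] [MeasurableSpace X] [MeasurableSpace Y]
  [DiscreteMeasurableSpace Y] {m : ℕ} {Φ : X → Y → Fin m → ℝ} {p : Measure (X × Y)}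
  [IsProbabilityMeasure p] {C : ℝ} {h : X → Y → ℝ} {μ : Fin m → ℝ}

theorem integrable_feature (hΦ : ∀ y, Measurable fun x => Φ x y) (hC : ∀ x y, ‖Φ x y‖ ≤ C)
    (i : Fin m) : Integrable (fun z : X × Y => Φ z.1 z.2 i) p := by
  refine Integrable.of_bound (C := C) (Measurable.aestronglyMeasurable ?_)
    (Filter.Eventually.of_forall fun z => (norm_le_pi_norm _ i).trans (hC _ _))
  exact measurable_from_prod_countable_left fun y => (measurable_pi_apply i).comp (hΦ y)

theorem integrable_score (hΦ : ∀ y, Measurable fun x => Φ x y) (hC : ∀ x y, ‖Φ x y‖ ≤ C)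
    (μ : Fin m → ℝ) : Integrable (fun z : X × Y => Φ z.1 z.2 ⬝ᵥ μ) p :=
  integrable_finsetSum _ fun i _ => (integrable_feature hΦ hC i).mul_const _

theorem IsRule.integrable (hh : IsRule h) : Integrable (fun z : X × Y => h z.1 z.2) p := by
  refine Integrable.of_bound (C := 1) (Measurable.aestronglyMeasurable ?_)
    (Filter.Eventually.of_forall fun z => ?_)
  · exact measurable_from_prod_countable_left fun y => hh.measurable y
  · rw [Real.norm_eq_abs, abs_of_nonneg ((hh.mem_simplex _).1 _)]
    exact hh.le_one _ _

/-- Separates a moment term, governed by the constraints of the uncertainty set, from a gap term,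
governed by sampling. -/
theorem risk_eq_add_integral (hΦ : ∀ y, Measurable fun x => Φ x y) (hC : ∀ x y, ‖Φ x y‖ ≤ C)
    (hh : IsRule h) (μ : Fin m → ℝ) :
    risk p h = 1 - ∫ z, Φ z.1 z.2 ⬝ᵥ μ ∂p + ∫ z, (Φ z.1 z.2 ⬝ᵥ μ - h z.1 z.2) ∂p := by
  rw [risk, integral_sub (integrable_const _) hh.integrable,
    integral_sub (integrable_score hΦ hC μ) hh.integrable]
  simp

theorem abs_integral_score_sub_le (hΦ : ∀ y, Measurable fun x => Φ x y)
    (hC : ∀ x y, ‖Φ x y‖ ≤ C) {τ lam : Fin m → ℝ} (hp : p ∈ uncertaintySet Φ τ lam)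
    (μ : Fin m → ℝ) : |∫ z, Φ z.1 z.2 ⬝ᵥ μ ∂p - τ ⬝ᵥ μ| ≤ ∑ i, lam i * |μ i| := by
  have h1 : ∫ z, Φ z.1 z.2 ⬝ᵥ μ ∂p = (fun i => ∫ z, Φ z.1 z.2 i ∂p) ⬝ᵥ μ := by
    unfold dotProduct
    rw [integral_finsetSum _ fun i _ => (integrable_feature hΦ hC i).mul_const _]
    simp_rw [integral_mul_const]
  rw [h1, ← sub_dotProduct]
  refine (Finset.abs_sum_le_sum_abs _ _).trans (Finset.sum_le_sum fun i _ => ?_)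
  rw [abs_mul]
  exact mul_le_mul_of_nonneg_right (hp.2 i) (abs_nonneg _)

/-- Generalization bound for the gaps `Φ(x, y)ᵀ μ' - h(y|x)` of the learned rule, from above
(`e = 1`) and from below (`e = -1`). -/
theorem mul_integral_gap_le (hΦ : ∀ y, Measurable fun x => Φ x y) (hC : ∀ x y, ‖Φ x y‖ ≤ C)
    {s : ℕ} (hs : 1 ≤ s) {S : Set X} {μ μ' : Fin m → ℝ} (hrule : IsRule (mrcRule Φ S μ)) {e M ε : ℝ}
    (he : e = 1 ∨ e = -1) (hsε : 1 / (s : ℝ) ≤ ε / 6)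
    (hM : ∃ x y, M = Φ x y ⬝ᵥ μ' - mrcRule Φ S μ x y)
    (hgood : ε < 1 → p.fst.real (signClass (ruleFunctionals Φ s e) (rulePatterns Y s e)
      (Sum.elim μ (Sum.elim μ' ![phi Φ S μ, M, 1]))) ≤ 5 / 6 * ε) :
    e * ∫ z, (Φ z.1 z.2 ⬝ᵥ μ' - mrcRule Φ S μ z.1 z.2) ∂p ≤
      e * M + ε * (2 * C * (∑ i, |μ' i|) + 1) := by
  obtain ⟨x₀, y₀, hM⟩ := hM
  have hC0 : 0 ≤ C := (norm_nonneg _).trans (hC x₀ y₀)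
  set r := 2 * C * (∑ i, |μ' i|) + 1 with hr
  have hr1 : 1 ≤ r := by
    have : 0 ≤ C * ∑ i, |μ' i| := mul_nonneg hC0 (Finset.sum_nonneg fun _ _ => abs_nonneg _)
    linarith
  have hs0 : (0 : ℝ) < 1 / s := by
    have : (0 : ℝ) < s := by exact_mod_cast hs
    positivity
  have hint : Integrable (fun z : X × Y => e * (Φ z.1 z.2 ⬝ᵥ μ' - mrcRule Φ S μ z.1 z.2)) p :=
    ((integrable_score hΦ hC μ').sub hrule.integrable).const_mul e
  have hrange : ∀ z : X × Y, e * (Φ z.1 z.2 ⬝ᵥ μ' - mrcRule Φ S μ z.1 z.2) ≤ e * M + r := by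
    intro z
    have h1 := abs_le.1 (abs_dotProduct_le_mul_sum (hC z.1 z.2) μ')
    have h2 := abs_le.1 (abs_dotProduct_le_mul_sum (hC x₀ y₀) μ')
    have h3 := (hrule.mem_simplex z.1).1 z.2
    have h4 := hrule.le_one z.1 z.2
    have h5 := (hrule.mem_simplex x₀).1 y₀
    have h6 := hrule.le_one x₀ y₀
    rw [hM, hr]
    rcases he with rfl | rfl <;> linarith
  rw [← integral_const_mul]
  -- With r ≥ 1 the range, the excess is at most 1/s + (5/6) ε r ≤ ε r. If ε ≥ 1, the range alone
  -- suffices.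
  by_cases hε : ε < 1
  · have h1 := integral_le_of_fst_measure_le p hint
      (measurableSet_signClass (measurable_ruleFunctionals hΦ s e) (rulePatterns Y s e) _)
      hs0.le (by linarith) (hgood hε)
      (fun z hz => not_lt.1 fun hlt => hz (mem_signClass_of_lt hs he hrule hlt)) hrange
    refine h1.trans ?_
    nlinarith
  · have h1 : ∫ z, e * (Φ z.1 z.2 ⬝ᵥ μ' - mrcRule Φ S μ z.1 z.2) ∂p ≤ e * M + r := by
      refine (integral_mono hint (integrable_const (e * M + r)) hrange).trans ?_
      simp
    nlinarith

end Generalization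

end MRC

/-! ### The main theorem -/

theorem mainTheorem5 {d m s : ℕ} (hs : 1 ≤ s)
    (𝒳 : Set (EuclideanSpace ℝ (Fin d))) (h𝒳 : MeasurableSet 𝒳)
    {Y : Type*} [Fintype Y] [MeasurableSpace Y] [DiscreteMeasurableSpace Y]
    (pstar : Measure (𝒳 × Y)) [IsProbabilityMeasure pstar]
    (Φ : 𝒳 → Y → Fin m → ℝ) (hΦ : Measurable fun z : 𝒳 × Y => Φ z.1 z.2)
    (C : ℝ) (hC : ∀ x y, ‖Φ x y‖ ≤ C)
    {Ω : Type*} [MeasurableSpace Ω] (P : Measure Ω) [IsProbabilityMeasure P]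
    -- the i.i.d. instances, and the (random) mean and confidence vectors, which may depend on them
    (x : Fin s → Ω → 𝒳) (hx : ∀ i, Measurable (x i)) (hindep : iIndepFun x P)
    (hlaw : ∀ i, P.map (x i) = pstar.fst)
    (τ lam : Ω → Fin m → ℝ) (δ : ℝ) (hδ : 0 < δ)
    -- with probability at least `1 - δ`, the uncertainty set is regular and contains `pstar`, and
    -- the optimal value of the learning problem on the sampled instances is finite
    (hU : ∃ A : Set Ω, MeasurableSet A ∧ 1 - δ ≤ P.real A ∧ ∀ ω ∈ A,
      pstar ∈ MRC.uncertaintySet Φ (τ ω) (lam ω) ∧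
      MRC.Regular Φ (τ ω) (lam ω) ∧
      BddBelow (Set.range (MRC.learnObj Φ (τ ω) (lam ω) (Set.range fun i => x i ω)))) :
    ∃ E : Set Ω, MeasurableSet E ∧ 1 - 2 * δ ≤ P.real E ∧ ∀ ω ∈ E,
      let Xs : Set 𝒳 := Set.range fun i => x i ω
      let ε : ℝ := MRC.epsilon (Fintype.card Y) m δ s
      (∃ μ, IsMinOn (MRC.learnObj Φ (τ ω) (lam ω) Xs) Set.univ μ) ∧
      ∀ μ, IsMinOn (MRC.learnObj Φ (τ ω) (lam ω) Xs) Set.univ μ →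
        let hrule : 𝒳 → Y → ℝ := MRC.mrcRule Φ Xs μ
        (∃ μl, IsMaxOn (MRC.lowerObj Φ (τ ω) (lam ω) Xs hrule) Set.univ μl) ∧
        (∃ μu, IsMinOn (MRC.upperObj Φ (τ ω) (lam ω) Xs hrule) Set.univ μu) ∧
        ∀ μl μu, IsMaxOn (MRC.lowerObj Φ (τ ω) (lam ω) Xs hrule) Set.univ μl →
          IsMinOn (MRC.upperObj Φ (τ ω) (lam ω) Xs hrule) Set.univ μu →
          MRC.lowerValue Φ (τ ω) (lam ω) Xs hrule - ε * (2 * C * (∑ i, |μl i|) + 1)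
              ≤ MRC.risk pstar hrule ∧
          MRC.risk pstar hrule
              ≤ MRC.upperValue Φ (τ ω) (lam ω) Xs + ε * (2 * C * (∑ i, |μu i|) + 1) ∧
          MRC.upperValue Φ (τ ω) (lam ω) Xs + ε * (2 * C * (∑ i, |μu i|) + 1)
              ≤ MRC.minimaxRisk (MRC.uncertaintySet Φ (τ ω) (lam ω))
                + ε * (2 * C * (∑ i, |μu i|) + 1) := by
  have hneXY : Nonempty (𝒳 × Y) := nonempty_of_isProbabilityMeasure pstar
  have hneY : Nonempty Y := hneXY.map Prod.snd
  have hΦ' : ∀ y, Measurable fun x => Φ x y := fun y =>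
    hΦ.comp (measurable_id.prodMk measurable_const)
  have hk : 1 ≤ Fintype.card Y := Fintype.card_pos
  -- For δ ≥ 1 the required probability 1 - 2δ is negative and the empty event serves.
  by_cases hδ1 : δ < 1
  swap
  · refine ⟨∅, MeasurableSet.empty, ?_, fun ω hω => hω.elim⟩
    simp only [measureReal_empty]
    linarith [not_lt.1 hδ1]
  obtain ⟨A, hA, hPA, hAω⟩ := hU
  obtain ⟨G, hG, hPG, hGω⟩ : ∃ G : Set Ω, MeasurableSet G ∧ P.real G ≤ δ ∧ ∀ ω ∉ G,
      MRC.epsilon (Fintype.card Y) m δ s < 1 → ∀ e : ℝ, (e = 1 ∨ e = -1) → ∀ θ,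
      (∀ i, x i ω ∉ signClass (MRC.ruleFunctionals Φ s e) (MRC.rulePatterns Y s e) θ) →
      pstar.fst.real (signClass (MRC.ruleFunctionals Φ s e) (MRC.rulePatterns Y s e) θ) ≤
        5 / 6 * MRC.epsilon (Fintype.card Y) m δ s := by
    by_cases hε : MRC.epsilon (Fintype.card Y) m δ s < 1
    · obtain ⟨G, hG, hPG, hGω⟩ := MRC.exists_exceptional_set hΦ' pstar.fst P hs x hx hindep hlaw
        hδ hδ1 hε
      exact ⟨G, hG, hPG, fun ω hω _ => hGω ω hω⟩
    · exact ⟨∅, MeasurableSet.empty, by simpa using hδ.le, fun ω _ h => absurd h hε⟩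
  refine ⟨A \ G, hA.diff hG, ?_, ?_⟩
  · have h1 := measureReal_mono (μ := P) (fun ω hω => by
      by_cases h : ω ∈ G
      · exact Or.inr h
      · exact Or.inl ⟨hω, h⟩ : A ⊆ A \ G ∪ G)
    have h2 := measureReal_union_le (μ := P) (A \ G) G
    linarith
  rintro ω ⟨hωA, hωG⟩ Xs ε
  obtain ⟨hp, -, hbdd⟩ := hAω ω hωA
  have hlam : ∀ i, 0 ≤ lam ω i := fun i => (abs_nonneg _).trans (hp.2 i)
  have hXs : Xs.Finite := Set.finite_range _
  have hXs' : Xs.Nonempty := ⟨x ⟨0, hs⟩ ω, ⟨0, hs⟩, rfl⟩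
  obtain ⟨μ₀, hμ₀, q, hq, hqrisk⟩ := MRC.exists_isMinOn_learnObj hXs hXs' hlam hbdd
  have hsε : 1 / (s : ℝ) ≤ ε / 6 := MRC.one_div_le_epsilon_div hk hs hδ hδ1
  refine ⟨⟨μ₀, hμ₀⟩, ?_⟩
  intro μ hμ hrule
  have hruleR : MRC.IsRule hrule := MRC.isRule_mrcRule hΦ' Xs μ
  have hval : MRC.upperValue Φ (τ ω) (lam ω) Xs = MRC.learnObj Φ (τ ω) (lam ω) Xs μ :=
    le_antisymm (ciInf_le hbdd μ) (le_ciInf fun μ' => hμ (Set.mem_univ μ'))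
  refine ⟨MRC.exists_isMaxOn_lowerObj hXs hXs' hlam (fun x y => (hruleR.mem_simplex x).1 y) hbdd,
    MRC.exists_isMinOn_upperObj hXs hXs' hlam hruleR.le_one hbdd,
    fun μl μu hμl hμu => ⟨?_, ?_, ?_⟩⟩
  · have hlval : MRC.lowerValue Φ (τ ω) (lam ω) Xs hrule ≤
        MRC.lowerObj Φ (τ ω) (lam ω) Xs hrule μl := ciSup_le fun μ' => hμl (Set.mem_univ μ')
    obtain ⟨x₁, hx₁, y₁, hM⟩ := (MRC.nonempty_gap_set (Φ := Φ) (h := hrule) (μ := μl)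
      hXs').csInf_mem (MRC.finite_gap_set hXs)
    have hmin : ∀ x' ∈ Xs, ∀ y, sInf {v | ∃ x ∈ Xs, ∃ y, v = Φ x y ⬝ᵥ μl - hrule x y} ≤
        Φ x' y ⬝ᵥ μl - hrule x' y := fun x' hx' y =>
      csInf_le (MRC.finite_gap_set hXs).bddBelow ⟨x', hx', y, rfl⟩
    have hgen := MRC.mul_integral_gap_le (p := pstar) hΦ' hC hs hruleR (Or.inr rfl) hsε
      ⟨x₁, y₁, hM⟩ fun hε => hGω ω hωG hε (-1) (Or.inr rfl) _ fun i =>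
        MRC.notMem_signClass_of_forall_le fun y => by
          have := hmin (x i ω) ⟨i, rfl⟩ y
          linarith
    have hrisk := MRC.risk_eq_add_integral (p := pstar) hΦ' hC hruleR μl
    have hscore := abs_le.1 (MRC.abs_integral_score_sub_le hΦ' hC hp μl)
    unfold MRC.lowerObj at hlval
    linarith [hscore.1, hscore.2]
  · have huval : MRC.upperObj Φ (τ ω) (lam ω) Xs hrule μu ≤
        MRC.upperValue Φ (τ ω) (lam ω) Xs := by
      rw [hval]
      -- The learned μ is itself a candidate in the upper problem.
      exact (hμu (Set.mem_univ μ)).trans (MRC.upperObj_mrcRule_le_learnObj hXs hXs')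
    obtain ⟨x₁, hx₁, y₁, hM⟩ := (MRC.nonempty_gap_set (Φ := Φ) (h := hrule) (μ := μu)
      hXs').csSup_mem (MRC.finite_gap_set hXs)
    have hmax : ∀ x' ∈ Xs, ∀ y, Φ x' y ⬝ᵥ μu - hrule x' y ≤
        sSup {v | ∃ x ∈ Xs, ∃ y, v = Φ x y ⬝ᵥ μu - hrule x y} := fun x' hx' y =>
      le_csSup (MRC.finite_gap_set hXs).bddAbove ⟨x', hx', y, rfl⟩
    have hgen := MRC.mul_integral_gap_le (p := pstar) hΦ' hC hs hruleR (Or.inl rfl) hsε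
      ⟨x₁, y₁, hM⟩ fun hε => hGω ω hωG hε 1 (Or.inl rfl) _ fun i =>
        MRC.notMem_signClass_of_forall_le fun y => by
          have := hmax (x i ω) ⟨i, rfl⟩ y
          linarith
    have hrisk := MRC.risk_eq_add_integral (p := pstar) hΦ' hC hruleR μu
    have hscore := abs_le.1 (MRC.abs_integral_score_sub_le hΦ' hC hp μu)
    unfold MRC.upperObj at huval
    linarith [hscore.1, hscore.2]
  · refine add_le_add_left ?_ _
    rw [hval]
    refine (hμ (Set.mem_univ μ₀)).trans ?_
    exact MRC.le_minimaxRisk (fun p hp => hp.1) hq hqrisk
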